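/- For a probability law $P$ on $\mathbb R$ with $\int|x|^3\,dP(x)<\infty$ let $\mu(P)=\int x\,dP(x)$ be its mean and $\sigma(P)\ge 0$ its standard deviation. Let $\mathcal P_3$ be the set of all such $P$ with $\sigma(P)>0$. For $P\in\mathcal P_3$ let $\widetilde P$ be the image of $P$ under $x\mapsto (x-\mu(P))/\sigma(P)$ and $\varrho(P)=\int |(x-\mu(P))/\sigma(P)|^3\,dP(x)\ (\ge 1)$. Write $Pf=\int f\,dP$, let $\ast$ denote convolution, and for $\varrho\ge 1$ put $$B(\varrho)=\sqrt{\tfrac12\varrho^2+\tfrac12\varrho\sqrt{\varrho^2+8}-2}.$$ For a Banach space $(E,|\cdot|)$ let $\mathcal C^{2,1}(\mathbb R,E)$ be the set of twice continuously differentiable $f:\mathbb R\to E$ with $\|f''\|_{\mathrm L}:=\sup_{x\ne y}|f''(x)-f''(y)|/|x-y|<\infty$. **Theorem.** Let $n\ge 1$, $P_1,\dots,P_n\in\mathcal P_3$, $\sigma_i=\sigma(P_i)$, $\varrho_i=\varrho(P_i)$, $\sigma=(\sum_{i=1}^n\sigma_i^2)^{1/2}$, $Q_i=\frac12(\delta_{-\sigma_i}+\delta_{\sigma_i})$,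 and let $E$ be a Banach space. (a) For every $f\in\mathcal C^{2,1}(\mathbb R,E)$, $f$ is integrable with respect to both standardized convolutions below, and $$\Bigl|\widetilde{P_1\ast\cdots\ast P_n}\,f-\widetilde{Q_1\ast\cdots\ast Q_n}\,f\Bigr|\le\frac{\|f''\|_{\mathrm L}}6\sum_{i=1}^n\frac{\sigma_i^3}{\sigma^3}B(\varrho_i).\qquad(1)$$ (b) If each $P_i$ is a two-point law, if the centred third moments $\int(x-\mu(P_i))^3\,dP_i(x)$ are all $\ge0$ or all $\le0$, and if $f(x)=cx^3$ for $x\in\mathbb R$ with a constant $c\in E$, then $f\in\mathcal C^{2,1}(\mathbb R,E)$ and equality holds in (1). (c) If $\sigma_1=\dots=\sigma_n$, then $\widetilde{Q_1\ast\cdots\ast Q_n}=\widetilde{\mathrm B_{n,1/2}}$, where $\mathrm B_{n,1/2}=(\frac12(\delta_0+\delta_1))^{\ast n}$ is the symmetric binomial law. (d) If $P_1=\dots=P_n=P$, then the right-hand side of (1) equals $\frac{B(\varrho(P))}{6\sqrt n}\|f''\|_{\mathrm L}$; thus for every $f\in\mathcal C^{2,1}(\mathbb R,E)$ $$\Bigl|\widetilde{P^{\ast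 n}}f-\widetilde{\mathrm B_{n,1/2}}f\Bigr|\le\frac{B(\varrho(P))}{6\sqrt n}\,\|f''\|_{\mathrm L},$$ with equality whenever $P$ is a two-point law and $f(x)=cx^3$ for $x\in\mathbb R$ with a constant $c\in E$. -/

import Mathlib

open MeasureTheory ProbabilityTheory

noncomputable section

namespace RademacherApprox

/-- The mean `μ(P)`. -/
def mean (P : Measure ℝ) : ℝ := ∫ x, x ∂P

/-- The standard deviation `σ(P)`. -/
def sd (P : Measure ℝ) : ℝ := √(Var[id; P])

/-- The class of probability laws on `ℝ` with finite third absolute moment and `σ(P) > 0`. -/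
structure IsP3 (P : Measure ℝ) : Prop where
  isProb : IsProbabilityMeasure P
  moment : Integrable (fun x : ℝ => |x| ^ 3) P
  sd_pos : 0 < sd P

/-- The standardization of `P`: its image under `x ↦ (x - μ(P)) / σ(P)`. -/
def standardize (P : Measure ℝ) : Measure ℝ := P.map (fun x => (x - mean P) / sd P)

/-- The standardized third absolute moment `ϱ(P)`. -/
def rho (P : Measure ℝ) : ℝ := ∫ x, |(x - mean P) / sd P| ^ 3 ∂P

/-- The centred third moment. -/
def centredThird (P : Measure ℝ) : ℝ := ∫ x, (x - mean P) ^ 3 ∂P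

/-- The function `B`. -/
def B (r : ℝ) : ℝ := √(r ^ 2 / 2 + r * √(r ^ 2 + 8) / 2 - 2)

/-- The convolution `P₁ ∗ ⋯ ∗ Pₙ`: the image of the product measure under addition. -/
def convolution {n : ℕ} (P : Fin n → Measure ℝ) : Measure ℝ :=
  (Measure.pi P).map (fun x => ∑ i, x i)

/-- The `n`-th convolution power. -/
def convPow (P : Measure ℝ) (n : ℕ) : Measure ℝ := convolution (fun _ : Fin n => P)

/-- The symmetric two-point law `½ (δ_{-s} + δ_s)`. -/
def symTwoPoint (s : ℝ) : Measure ℝ :=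
  (2⁻¹ : ENNReal) • (Measure.dirac (-s) + Measure.dirac s)

/-- The symmetric binomial law `(½ (δ_0 + δ_1))^{∗ n}`. -/
def symBinomial (n : ℕ) : Measure ℝ :=
  convPow ((2⁻¹ : ENNReal) • (Measure.dirac 0 + Measure.dirac 1)) n

/-- Laws concentrated on two distinct points, both of positive mass. -/
def IsTwoPoint (P : Measure ℝ) : Prop :=
  ∃ a b p : ℝ, a ≠ b ∧ 0 < p ∧ p < 1 ∧
    P = ENNReal.ofReal p • Measure.dirac a + ENNReal.ofReal (1 - p) • Measure.dirac b

section

variable {E : Type*} [NormedAddCommGroup E]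

/-- The set of difference quotients of `g` whose supremum is its Lipschitz constant. -/
def lipQuotients (g : ℝ → E) : Set ℝ :=
  {r | ∃ x y : ℝ, x ≠ y ∧ r = ‖g x - g y‖ / |x - y|}

/-- The Lipschitz constant `‖g‖_L`; used only for `g` with `lipQuotients g` bounded. -/
def lipNorm (g : ℝ → E) : ℝ := sSup (lipQuotients g)

/-- `f ∈ C^{2,1}(ℝ, E)`: twice continuously differentiable with Lipschitz second derivative. -/
def IsC21 [NormedSpace ℝ E] (f : ℝ → E) : Prop :=
  ContDiff ℝ 2 f ∧ BddAbove (lipQuotients (iteratedDeriv 2 f))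

end

end RademacherApprox

end

/-! The convolution bound reduces to a single standardized law `ν` by Lindeberg replacement: the
class of functions with `L`-Lipschitz second derivative is translation invariant, so the laws can be
exchanged one at a time and the errors add up (`norm_integral_convolution_sub_le`). Rescaling a
summand multiplies `L` by the cube of the scale, which produces the weights `σᵢ³/σ³`.

For one law with third absolute moment `r`, a norming functional makes `f` real. The extremal
candidates are the standardized two-point laws on `{b, -1/b}`, with third moment `b - 1/b`; their
third absolute moment is `twoPointRho t` with `t = |b - 1/b|`, and `B` inverts `twoPointRho`.
Subtract `L * lam / 6 * |x|^3` from `f`, with a multiplier `lam > 1`: the second derivative becomes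
tent-shaped, and such a function has a quadratic majorant touching it at `b` and `-1/b` for some `b`
(`TentSecond.exists_quadratic`). Integrating the majorant compares `ν` with that two-point law.

It remains to compare two-point laws with the symmetric one, which costs at most `L/6 * |b - 1/b|`
(`LipSecond.twoPointMean_sub_le`), and to pay for the multiplier. With `lam` the slope at `T` of the
inverse of `twoPointRho`, the tangent inequality `le_tangent` makes the total at most `L/6 * T` for
each `T > B r`; then `T` tends to `B r`.

Equality for cubes: third moments of centred laws are additive, those of the symmetric laws vanish,
and for two-point laws `σ³ B(ϱ)` is the absolute centred third moment, so equal signs prevent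
cancellation. -/

namespace RademacherApprox

/-! ### Sign lemmas obtained from Rolle's theorem -/

/-- A function lies above zero if it has two double zeros `u < 0 < v` and its second derivative is
strictly decreasing on the left and strictly increasing on the right of `0`. -/
theorem nonneg_of_double_zeros {D D₁ D₂ : ℝ → ℝ} (h₁ : ∀ x, HasDerivAt D (D₁ x) x)
    (h₂ : ∀ x, HasDerivAt D₁ (D₂ x) x) (hanti : StrictAntiOn D₂ (Set.Iic 0))
    (hmono : StrictMonoOn D₂ (Set.Ici 0)) {u v : ℝ} (hu : u < 0) (hv : 0 < v)
    (hDu : D u = 0) (hDv : D v = 0) (hDu' : D₁ u = 0) (hDv' : D₁ v = 0) (x : ℝ) : 0 ≤ D x := by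
  have c₁ : Continuous D := continuous_iff_continuousAt.2 fun x => (h₁ x).continuousAt
  have c₂ : Continuous D₁ := continuous_iff_continuousAt.2 fun x => (h₂ x).continuousAt
  obtain ⟨w, hw, hw0⟩ := exists_hasDerivAt_eq_zero (hu.trans hv) c₁.continuousOn
    (hDu.trans hDv.symm) fun x _ => h₁ x
  obtain ⟨z₁, hz₁, hz₁0⟩ := exists_hasDerivAt_eq_zero hw.1 c₂.continuousOn
    (hDu'.trans hw0.symm) fun x _ => h₂ x
  obtain ⟨z₂, hz₂, hz₂0⟩ := exists_hasDerivAt_eq_zero hw.2 c₂.continuousOn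
    (hw0.trans hDv'.symm) fun x _ => h₂ x
  have hz : z₁ < z₂ := hz₁.2.trans hz₂.1
  have z₁neg : z₁ < 0 := by
    by_contra! h
    have := hmono (Set.mem_Ici.2 h) (Set.mem_Ici.2 (h.trans hz.le)) hz
    linarith
  have z₂pos : 0 < z₂ := by
    by_contra! h
    have := hanti (Set.mem_Iic.2 (hz.le.trans h)) (Set.mem_Iic.2 h) hz
    linarith
  -- `D` is convex, concave, convex on the pieces cut out by `z₁ < z₂`. Each outer piece contains a
  -- double zero and lies above its tangent there, which is zero; the middle piece then lies above a
  -- nonnegative chord.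
  have left : ∀ y ≤ z₁, 0 ≤ D₂ y := fun y hy => by
    have := hanti.antitoneOn (Set.mem_Iic.2 (hy.trans z₁neg.le)) (Set.mem_Iic.2 z₁neg.le) hy
    linarith
  have right : ∀ y, z₂ ≤ y → 0 ≤ D₂ y := fun y hy => by
    have := hmono.monotoneOn (Set.mem_Ici.2 z₂pos.le) (Set.mem_Ici.2 (z₂pos.le.trans hy)) hy
    linarith
  have mid : ∀ y, z₁ ≤ y → y ≤ z₂ → D₂ y ≤ 0 := fun y hy hy' => by
    rcases le_total y 0 with h | h
    · have := hanti.antitoneOn (Set.mem_Iic.2 z₁neg.le) (Set.mem_Iic.2 h) hy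
      linarith
    · have := hmono.monotoneOn (Set.mem_Ici.2 h) (Set.mem_Ici.2 z₂pos.le) hy'
      linarith
  have L : ∀ y ≤ z₁, 0 ≤ D y := fun y hy => by
    rcases lt_trichotomy y u with h | h | h
    · obtain ⟨ξ, hξ, e⟩ := exists_hasDerivAt_eq_slope D D₁ h c₁.continuousOn fun x _ => h₁ x
      obtain ⟨η, hη, e'⟩ := exists_hasDerivAt_eq_slope D₁ D₂ hξ.2 c₂.continuousOn fun x _ => h₂ x
      rw [eq_div_iff (by linarith [hξ.1, hξ.2])] at e e'
      have h0 := left η (by linarith [hη.2, hz₁.1])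
      nlinarith [mul_nonneg h0 (sub_nonneg.2 hξ.2.le)]
    · rw [h, hDu]
    · obtain ⟨ξ, hξ, e⟩ := exists_hasDerivAt_eq_slope D D₁ h c₁.continuousOn fun x _ => h₁ x
      obtain ⟨η, hη, e'⟩ := exists_hasDerivAt_eq_slope D₁ D₂ hξ.1 c₂.continuousOn fun x _ => h₂ x
      rw [eq_div_iff (by linarith [hξ.1, hξ.2])] at e e'
      have h0 := left η (by linarith [hη.2, hξ.2])
      nlinarith [mul_nonneg h0 (sub_nonneg.2 hξ.1.le)]
  have R : ∀ y, z₂ ≤ y → 0 ≤ D y := fun y hy => by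
    rcases lt_trichotomy y v with h | h | h
    · obtain ⟨ξ, hξ, e⟩ := exists_hasDerivAt_eq_slope D D₁ h c₁.continuousOn fun x _ => h₁ x
      obtain ⟨η, hη, e'⟩ := exists_hasDerivAt_eq_slope D₁ D₂ hξ.2 c₂.continuousOn fun x _ => h₂ x
      rw [eq_div_iff (by linarith [hξ.1, hξ.2])] at e e'
      have h0 := right η (by linarith [hη.1, hξ.1])
      nlinarith [mul_nonneg h0 (sub_nonneg.2 hξ.2.le)]
    · rw [h, hDv]
    · obtain ⟨ξ, hξ, e⟩ := exists_hasDerivAt_eq_slope D D₁ h c₁.continuousOn fun x _ => h₁ x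
      obtain ⟨η, hη, e'⟩ := exists_hasDerivAt_eq_slope D₁ D₂ hξ.1 c₂.continuousOn fun x _ => h₂ x
      rw [eq_div_iff (by linarith [hξ.1, hξ.2])] at e e'
      have h0 := right η (by linarith [hη.1, hz₂.2])
      nlinarith [mul_nonneg h0 (sub_nonneg.2 hξ.1.le)]
  rcases le_or_gt x z₁ with h | hx₁
  · exact L x h
  rcases le_or_gt z₂ x with h | hx₂
  · exact R x h
  by_contra! hneg
  obtain ⟨ξ, hξ, e⟩ := exists_hasDerivAt_eq_slope D D₁ hx₁ c₁.continuousOn fun x _ => h₁ x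
  obtain ⟨ζ, hζ, e'⟩ := exists_hasDerivAt_eq_slope D D₁ hx₂ c₁.continuousOn fun x _ => h₁ x
  have hlt : ξ < ζ := hξ.2.trans hζ.1
  obtain ⟨η, hη, e''⟩ := exists_hasDerivAt_eq_slope D₁ D₂ hlt c₂.continuousOn fun x _ => h₂ x
  have i₁ : D₁ ξ < 0 := by
    rw [e]; exact div_neg_of_neg_of_pos (by linarith [L z₁ le_rfl]) (by linarith)
  have i₂ : 0 < D₁ ζ := by
    rw [e']; exact div_pos (by linarith [R z₂ le_rfl]) (by linarith)
  have i₃ : 0 < D₂ η := by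
    rw [e'']; exact div_pos (by linarith) (by linarith)
  linarith [mid η (by linarith [hξ.1, hη.1]) (by linarith [hζ.2, hη.2])]

/-- Nonnegativity of the third divided difference of a function with monotone second derivative. -/
theorem nonneg_of_three_zeros {h h₁ h₂ : ℝ → ℝ} (d₁ : ∀ x, HasDerivAt h (h₁ x) x)
    (d₂ : ∀ x, HasDerivAt h₁ (h₂ x) x) (hm : Monotone h₂) {x₀ x₁ x₂ x₃ : ℝ} (h01 : x₀ < x₁)
    (h12 : x₁ < x₂) (h23 : x₂ < x₃) (e₀ : h x₀ = 0) (e₁ : h x₁ = 0) (e₂ : h x₂ = 0) :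
    0 ≤ h x₃ := by
  have c₁ : Continuous h := continuous_iff_continuousAt.2 fun x => (d₁ x).continuousAt
  have c₂ : Continuous h₁ := continuous_iff_continuousAt.2 fun x => (d₂ x).continuousAt
  -- Rolle twice gives a zero `η` of `h₂` to the left of a zero `ζ < x₂` of `h₁`. Past `ζ` both `h₂`
  -- and `h₁` are nonnegative, so `h` cannot fall after its zero `x₂`.
  obtain ⟨ξ, hξ, hξ0⟩ := exists_hasDerivAt_eq_zero h01 c₁.continuousOn
    (e₀.trans e₁.symm) fun x _ => d₁ x
  obtain ⟨ζ, hζ, hζ0⟩ := exists_hasDerivAt_eq_zero h12 c₁.continuousOn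
    (e₁.trans e₂.symm) fun x _ => d₁ x
  obtain ⟨η, hη, hη0⟩ := exists_hasDerivAt_eq_zero (hξ.2.trans hζ.1) c₂.continuousOn
    (hξ0.trans hζ0.symm) fun x _ => d₂ x
  obtain ⟨y, hy, e⟩ := exists_hasDerivAt_eq_slope h h₁ h23 c₁.continuousOn fun x _ => d₁ x
  obtain ⟨z, hz, e'⟩ := exists_hasDerivAt_eq_slope h₁ h₂ (hζ.2.trans hy.1) c₂.continuousOn
    fun x _ => d₂ x
  rw [eq_div_iff (by linarith [hζ.2, hy.1])] at e e'
  have := hm (show η ≤ z by linarith [hη.2, hz.1])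
  have i₁ : 0 ≤ h₁ y := by
    have := mul_nonneg (hη0 ▸ this) (sub_nonneg.2 (hζ.2.trans hy.1).le)
    linarith
  have := mul_nonneg i₁ (sub_nonneg.2 h23.le)
  linarith

/-! ### Standardized two-point laws against the symmetric one -/

/-- Expectation of `f` under the standardized two-point law on `{b, -1/b}`. -/
noncomputable def twoPointMean (f : ℝ → ℝ) (b : ℝ) : ℝ := (f b + b ^ 2 * f (-b⁻¹)) / (1 + b ^ 2)

/-- Both laws give the same mean to every quadratic, so subtract the quadratic interpolating `h` at
`-1`, `-1/b`, `1`. Only the remainder at `b` is left, and its sign is that of a third divided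
difference. -/
theorem symmetric_le_twoPointMean {h h₁ h₂ : ℝ → ℝ} (d₁ : ∀ x, HasDerivAt h (h₁ x) x)
    (d₂ : ∀ x, HasDerivAt h₁ (h₂ x) x) (hm : Monotone h₂) {b : ℝ} (hb : 1 ≤ b) :
    (h 1 + h (-1)) / 2 ≤ twoPointMean h b := by
  rcases hb.eq_or_lt with rfl | hb
  · simp [twoPointMean]; norm_num
  have hb0 : 0 < b := by linarith
  have hi : b⁻¹ < 1 := inv_lt_one_of_one_lt₀ hb
  have hi0 : 0 < b⁻¹ := inv_pos.2 hb0
  obtain ⟨c, hc⟩ : ∃ c, c = b⁻¹ := ⟨_, rfl⟩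
  have hbc : b * c = 1 := by rw [hc]; field_simp
  rw [twoPointMean, ← hc]
  rw [← hc] at hi hi0
  obtain ⟨s, hs⟩ : ∃ s, s = (h 1 - h (-1)) / 2 := ⟨_, rfl⟩
  obtain ⟨γ, hγ⟩ : ∃ γ, γ = (h (-c) - h (-1) - s * (1 - c)) / (c ^ 2 - 1) := ⟨_, rfl⟩
  have hne : c ^ 2 - 1 ≠ 0 := by nlinarith
  rw [eq_div_iff hne] at hγ
  have key : 0 ≤ h b - (h (-1) + s * (b + 1) + γ * (b ^ 2 - 1)) := by
    refine nonneg_of_three_zeros (h := fun x => h x - (h (-1) + s * (x + 1) + γ * (x ^ 2 - 1)))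
      (h₁ := fun x => h₁ x - (s + γ * (2 * x))) (h₂ := fun x => h₂ x - γ * 2)
      (x₀ := -1) (x₁ := -c) (x₂ := 1) (fun x => ?_) (fun x => ?_)
      (fun x y hxy => sub_le_sub_right (hm hxy) _) (by linarith) (by linarith) hb ?_ ?_ ?_
    · have := (d₁ x).sub ((((hasDerivAt_id x).add_const 1).const_mul s |>.const_add (h (-1))).add
        ((((hasDerivAt_id x).pow 2).sub_const 1).const_mul γ))
      refine this.congr_deriv ?_; simp
    · have := (d₂ x).sub ((((hasDerivAt_id x).const_mul 2).const_mul γ).const_add s)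
      refine this.congr_deriv ?_; simp
    · ring
    · linear_combination -hγ
    · rw [hs]; ring
  rw [le_div_iff₀ (by positivity)]
  have e : b ^ 2 * h (-c) = b ^ 2 * (h (-1) + s * (1 - c)) + γ * (1 - b ^ 2) := by
    linear_combination -b ^ 2 * hγ + γ * (b * c + 1) * hbc
  rw [e]
  have e2 : (h 1 + h (-1)) / 2 = h (-1) + s := by rw [hs]; ring
  rw [e2]
  have e3 : b ^ 2 * (s * (1 - c)) = s * b ^ 2 - s * b := by linear_combination - s * b * hbc
  nlinarith [key, e3]

/-- `f` is twice differentiable with derivatives `f₁`, `f₂`, and `f₂` is `L`-Lipschitz. -/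
structure LipSecond {E : Type*} [NormedAddCommGroup E] [NormedSpace ℝ E] (f f₁ f₂ : ℝ → E)
    (L : ℝ) : Prop where
  d₁ : ∀ x, HasDerivAt f (f₁ x) x
  d₂ : ∀ x, HasDerivAt f₁ (f₂ x) x
  lip : ∀ x y, ‖f₂ x - f₂ y‖ ≤ L * |x - y|

theorem LipSecond.neg_comp_neg {f f₁ f₂ : ℝ → ℝ} {L : ℝ} (h : LipSecond f f₁ f₂ L) :
    LipSecond (fun x => f (-x)) (fun x => -f₁ (-x)) (fun x => f₂ (-x)) L where
  d₁ x := ((h.d₁ (-x)).scomp x (hasDerivAt_neg x)).congr_deriv (by simp)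
  d₂ x := ((h.d₂ (-x)).scomp x (hasDerivAt_neg x)).neg.congr_deriv (by simp)
  lip x y := by
    refine (h.lip _ _).trans_eq ?_
    rw [← abs_neg]; congr 2; ring

theorem LipSecond.twoPointMean_sub_le_of_one_le {f f₁ f₂ : ℝ → ℝ} {L : ℝ}
    (h : LipSecond f f₁ f₂ L) {b : ℝ} (hb : 1 ≤ b) :
    twoPointMean f b - (f 1 + f (-1)) / 2 ≤ L / 6 * (b - b⁻¹) := by
  have hb0 : 0 < b := by linarith
  -- The cubic makes the second derivative monotone, and contributes its third moment `b - 1/b`; the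
  -- symmetric law has third moment zero.
  have := symmetric_le_twoPointMean (h := fun x => L / 6 * x ^ 3 - f x)
    (h₁ := fun x => L / 2 * x ^ 2 - f₁ x) (h₂ := fun x => L * x - f₂ x)
    (fun x => (((hasDerivAt_pow 3 x).const_mul (L / 6)).sub (h.d₁ x)).congr_deriv (by norm_num; ring))
    (fun x => (((hasDerivAt_pow 2 x).const_mul (L / 2)).sub (h.d₂ x)).congr_deriv (by norm_num; ring))
    (fun x y hxy => by
      have := (le_abs_self _).trans (h.lip y x)
      rw [abs_of_nonneg (sub_nonneg.2 hxy)] at this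
      simp only; linarith) hb
  have e : twoPointMean (fun x => L / 6 * x ^ 3 - f x) b =
      L / 6 * (b - b⁻¹) - twoPointMean f b := by
    unfold twoPointMean; field_simp; ring
  rw [e] at this
  linarith

theorem LipSecond.twoPointMean_sub_le {f f₁ f₂ : ℝ → ℝ} {L : ℝ}
    (h : LipSecond f f₁ f₂ L) {b : ℝ} (hb : 0 < b) :
    twoPointMean f b - (f 1 + f (-1)) / 2 ≤ L / 6 * |b - b⁻¹| := by
  rcases le_total 1 b with h1 | h1
  · rw [abs_of_nonneg (sub_nonneg.2 ((inv_le_one_of_one_le₀ h1).trans h1))]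
    exact h.twoPointMean_sub_le_of_one_le h1
  -- Reflection in the origin exchanges `b` and `1/b`.
  · have := h.neg_comp_neg.twoPointMean_sub_le_of_one_le (one_le_inv_iff₀.2 ⟨hb, h1⟩)
    rw [abs_sub_comm, abs_of_nonneg (sub_nonneg.2 (h1.trans (one_le_inv_iff₀.2 ⟨hb, h1⟩)))]
    rw [inv_inv] at this
    refine le_trans (le_of_eq ?_) this
    unfold twoPointMean
    simp only [inv_inv, neg_neg]
    field_simp
    ring

/-! ### Quadratic majorants of functions with tent-shaped second derivative -/

theorem hasDerivAt_mul_abs (x : ℝ) : HasDerivAt (fun x : ℝ => x * |x|) (2 * |x|) x := by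
  rcases lt_trichotomy x 0 with h | rfl | h
  · rw [abs_of_neg h]
    refine ((hasDerivAt_id x).mul (hasDerivAt_abs_neg h)).congr_deriv ?_
    simp [abs_of_neg h]; ring
  · rw [hasDerivAt_iff_tendsto_slope]
    have : Filter.Tendsto (fun y : ℝ => |y|) (nhdsWithin 0 {0}ᶜ) (nhds (2 * |0|)) := by
      have := (continuous_abs (G := ℝ)).tendsto 0
      simp only [abs_zero, mul_zero] at this ⊢
      exact this.mono_left nhdsWithin_le_nhds
    refine this.congr' ?_
    filter_upwards [self_mem_nhdsWithin] with y hy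
    rw [slope_def_field]; field_simp [show y ≠ 0 from hy]; simp
  · rw [abs_of_pos h]
    refine ((hasDerivAt_id x).mul (hasDerivAt_abs_pos h)).congr_deriv ?_
    simp [abs_of_pos h]; ring

theorem hasDerivAt_abs_pow_three (x : ℝ) :
    HasDerivAt (fun x : ℝ => |x| ^ 3) (3 * (x * |x|)) x := by
  have : (fun x : ℝ => |x| ^ 3) = fun x => x * (x * |x|) := by
    funext y; rw [pow_succ, sq_abs]; ring
  rw [this]
  exact ((hasDerivAt_id x).mul (hasDerivAt_mul_abs x)).congr_deriv (by simp; ring)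

/-- `F` is twice differentiable with derivatives `F₁`, `F₂`, where `F₂` is `M`-Lipschitz, increases
at rate at least `m` on `(-∞, 0]` and decreases at rate at least `m` on `[0, ∞)`. -/
structure TentSecond (F F₁ F₂ : ℝ → ℝ) (m M : ℝ) : Prop where
  d₁ : ∀ x, HasDerivAt F (F₁ x) x
  d₂ : ∀ x, HasDerivAt F₁ (F₂ x) x
  right : ∀ x y, 0 ≤ x → x ≤ y → F₂ y - F₂ x ≤ -m * (y - x)
  left : ∀ x y, x ≤ y → y ≤ 0 → m * (y - x) ≤ F₂ y - F₂ x
  lip : ∀ x y, |F₂ x - F₂ y| ≤ M * |x - y|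

namespace TentSecond

variable {F F₁ F₂ : ℝ → ℝ} {m M : ℝ}

theorem neg_comp_neg (h : TentSecond F F₁ F₂ m M) :
    TentSecond (fun x => F (-x)) (fun x => -F₁ (-x)) (fun x => F₂ (-x)) m M where
  d₁ x := ((h.d₁ (-x)).scomp x (hasDerivAt_neg x)).congr_deriv (by simp)
  d₂ x := ((h.d₂ (-x)).scomp x (hasDerivAt_neg x)).neg.congr_deriv (by simp)
  right x y hx hy := by linarith [h.left (-y) (-x) (by linarith) (by linarith)]
  left x y hx hy := by linarith [h.right (-y) (-x) (by linarith) (by linarith)]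
  lip x y := by
    refine (h.lip _ _).trans_eq ?_
    rw [← abs_neg]; congr 2; ring

/-- The defect of the trapezoidal rule ignores quadratic parts of `F`, so its sign may be estimated
with the 2-jet at `0` removed. -/
theorem sub_taylor (h : TentSecond F F₁ F₂ m M) :
    TentSecond (fun x => F x - (F 0 + F₁ 0 * x + F₂ 0 / 2 * x ^ 2))
      (fun x => F₁ x - (F₁ 0 + F₂ 0 * x)) (fun x => F₂ x - F₂ 0) m M where
  d₁ x := ((h.d₁ x).sub ((((hasDerivAt_id x).const_mul (F₁ 0)).const_add (F 0)).add
    (((hasDerivAt_id x).pow 2).const_mul (F₂ 0 / 2)))).congr_deriv (by simp; ring)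
  d₂ x := ((h.d₂ x).sub (((hasDerivAt_id x).const_mul (F₂ 0)).const_add (F₁ 0))).congr_deriv
    (by simp)
  right x y hx hy := by linarith [h.right x y hx hy]
  left x y hx hy := by linarith [h.left x y hx hy]
  lip x y := by
    refine le_trans (le_of_eq ?_) (h.lip x y)
    congr 1; ring

theorem continuous (h : TentSecond F F₁ F₂ m M) : Continuous F :=
  continuous_iff_continuousAt.2 fun x => (h.d₁ x).continuousAt

theorem continuous_deriv (h : TentSecond F F₁ F₂ m M) : Continuous F₁ :=
  continuous_iff_continuousAt.2 fun x => (h.d₂ x).continuousAt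

/-- These are the terms of the defect at the far endpoint; strict concavity of `F₁` on the right
makes them negative of cubic order, which decides the sign for large `b`. -/
theorem right_bounds (h : TentSecond F F₁ F₂ m M) (hm : 0 < m) (h₀ : F 0 = 0)
    (h₁ : F₁ 0 = 0) (h₂ : F₂ 0 = 0) {v : ℝ} (hv : 0 < v) :
    F₁ v ≤ 0 ∧ F₁ v * v - 2 * F v ≤ -m * v ^ 3 / 6 := by
  have slope : ∀ v, 0 < v → F₁ v ≤ 0 ∧ v * (F₂ v + m * v / 2) ≤ F₁ v := by
    intro v hv
    have hd : ∀ x, HasDerivAt (fun x => F₁ x + m / 2 * x ^ 2) (F₂ x + m * x) x := fun x =>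
      ((h.d₂ x).add ((hasDerivAt_pow 2 x).const_mul (m / 2))).congr_deriv (by norm_num; ring)
    obtain ⟨ξ, hξ, e⟩ := exists_hasDerivAt_eq_slope (fun x => F₁ x + m / 2 * x ^ 2)
      (fun x => F₂ x + m * x) hv
      (Continuous.continuousOn (continuous_iff_continuousAt.2 fun x => (hd x).continuousAt))
      fun x _ => hd x
    rw [eq_div_iff (by linarith)] at e
    have i₁ := h.right ξ v hξ.1.le hξ.2.le
    have i₂ := h.right 0 ξ le_rfl hξ.1.le
    have j₁ : v * (F₂ v + m * v) ≤ v * (F₂ ξ + m * ξ) :=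
      mul_le_mul_of_nonneg_left (by linarith) hv.le
    have j₂ : v * (F₂ ξ + m * ξ) ≤ 0 := mul_nonpos_of_nonneg_of_nonpos hv.le (by linarith)
    have j₃ : 0 ≤ m * v ^ 2 := by positivity
    constructor <;> nlinarith
  refine ⟨(slope v hv).1, ?_⟩
  -- The derivative of this auxiliary function is nonpositive by the second half of `slope`, and the
  -- function vanishes at `0`.
  have hd : ∀ x, HasDerivAt (fun x => F₁ x * x - 2 * F x + m / 6 * x ^ 3)
      (F₂ x * x - F₁ x + m / 2 * x ^ 2) x := fun x =>
    ((((h.d₂ x).mul (hasDerivAt_id x)).sub ((h.d₁ x).const_mul 2)).add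
      ((hasDerivAt_pow 3 x).const_mul (m / 6))).congr_deriv (by norm_num; ring)
  obtain ⟨ξ, hξ, e⟩ := exists_hasDerivAt_eq_slope (fun x => F₁ x * x - 2 * F x + m / 6 * x ^ 3)
    (fun x => F₂ x * x - F₁ x + m / 2 * x ^ 2) hv
    (Continuous.continuousOn (continuous_iff_continuousAt.2 fun x => (hd x).continuousAt))
    fun x _ => hd x
  rw [eq_div_iff (by linarith)] at e
  have i := (slope ξ hξ.1).2
  have := mul_nonpos_of_nonpos_of_nonneg
    (show F₂ ξ * ξ - F₁ ξ + m / 2 * ξ ^ 2 ≤ 0 by linarith) (show 0 ≤ v - 0 by linarith)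
  rw [e] at this
  simp only [h₀] at this
  linarith

theorem left_bounds (h : TentSecond F F₁ F₂ m M) (hM : 0 ≤ M) (h₀ : F 0 = 0)
    (h₁ : F₁ 0 = 0) (h₂ : F₂ 0 = 0) {c : ℝ} (hc : 0 < c) :
    F₁ (-c) ≤ M * c ^ 2 ∧ F (-c) ≤ M * c ^ 3 := by
  have slope : ∀ c, 0 < c → |F₁ (-c)| ≤ M * c ^ 2 := by
    intro c hc
    obtain ⟨ξ, hξ, e⟩ := exists_hasDerivAt_eq_slope F₁ F₂ (neg_lt_zero.2 hc)
      h.continuous_deriv.continuousOn fun x _ => h.d₂ x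
    rw [eq_div_iff (by linarith)] at e
    have i := h.lip ξ 0
    rw [h₂, sub_zero, sub_zero, abs_of_neg hξ.2] at i
    have e' : F₁ (-c) = -(F₂ ξ * c) := by linarith
    rw [e', abs_neg, abs_mul, abs_of_pos hc]
    have : |F₂ ξ| ≤ M * c := i.trans (mul_le_mul_of_nonneg_left (by linarith [hξ.1]) hM)
    nlinarith
  refine ⟨(le_abs_self _).trans (slope c hc), ?_⟩
  obtain ⟨ξ, hξ, e⟩ := exists_hasDerivAt_eq_slope F F₁ (neg_lt_zero.2 hc)
    h.continuous.continuousOn fun x _ => h.d₁ x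
  rw [eq_div_iff (by linarith)] at e
  have i := slope (-ξ) (by linarith [hξ.2])
  rw [neg_neg] at i
  have i' : |F₁ ξ| ≤ M * c ^ 2 := i.trans
    (mul_le_mul_of_nonneg_left (pow_le_pow_left₀ (by linarith [hξ.2]) (by linarith [hξ.1]) 2) hM)
  have := (neg_le_abs (F₁ ξ)).trans i'
  nlinarith

/-- The defect of the trapezoidal rule for `F₁` on `[-1/b, b]`. -/
noncomputable def defect (F F₁ : ℝ → ℝ) (b : ℝ) : ℝ :=
  (F₁ b + F₁ (-b⁻¹)) * (b + b⁻¹) - 2 * (F b - F (-b⁻¹))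

/-- The far endpoint contributes at most `-m b³/6`, everything involving `-1/b` at most `4 M b`;
hence the constant `24 = 6 * 4`. The summand `1` in the threshold ensures `1/b ≤ 1 ≤ b`. -/
theorem defect_nonpos (h : TentSecond F F₁ F₂ m M) (hm : 0 < m) (hM : 0 ≤ M) {b : ℝ}
    (hb : 1 + 24 * M / m ≤ b) : defect F F₁ b ≤ 0 := by
  have hq : 0 ≤ 24 * M / m := by positivity
  have hb1 : 1 ≤ b := by linarith
  have hb0 : 0 < b := by linarith
  have hMb : 24 * M ≤ m * b := by
    have : 24 * M / m ≤ b := by linarith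
    rw [div_le_iff₀ hm] at this; linarith
  obtain ⟨c, hc⟩ : ∃ c, c = b⁻¹ := ⟨_, rfl⟩
  have hbc : b * c = 1 := by rw [hc]; field_simp
  have hc0 : 0 < c := hc ▸ inv_pos.2 hb0
  have hc1 : c ≤ 1 := hc ▸ inv_le_one_of_one_le₀ hb1
  obtain ⟨r₁, r₂⟩ := h.sub_taylor.right_bounds hm (by simp) (by simp) (by simp) hb0
  obtain ⟨l₁, l₂⟩ := h.sub_taylor.left_bounds hM (by simp) (by simp) (by simp) hc0
  simp only [defect]
  rw [← hc]
  set G := fun x => F x - (F 0 + F₁ 0 * x + F₂ 0 / 2 * x ^ 2)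
  set G₁ := fun x => F₁ x - (F₁ 0 + F₂ 0 * x)
  have e : (F₁ b + F₁ (-c)) * (b + c) - 2 * (F b - F (-c)) =
      (G₁ b + G₁ (-c)) * (b + c) - 2 * (G b - G (-c)) := by
    simp only [G, G₁]; ring
  rw [e]
  have j₁ : G₁ b * c ≤ 0 := mul_nonpos_of_nonpos_of_nonneg r₁ hc0.le
  have j₂ : G₁ (-c) * (b + c) ≤ M * c ^ 2 * (b + c) :=
    mul_le_mul_of_nonneg_right l₁ (by positivity)
  have k₂ : c ^ 2 ≤ 1 := pow_le_one₀ hc0.le hc1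
  have k₃ : c ^ 3 ≤ 1 := pow_le_one₀ hc0.le hc1
  have j₃ : M * c ^ 2 * (b + c) ≤ M * (2 * b) := by
    rw [mul_assoc]
    exact mul_le_mul_of_nonneg_left (by nlinarith) hM
  have j₄ : M * c ^ 3 ≤ M * b := mul_le_mul_of_nonneg_left (by linarith) hM
  have j₅ : 24 * M * b ≤ m * b ^ 3 := by
    have : m * b * b ≤ m * b * b ^ 2 :=
      mul_le_mul_of_nonneg_left (by nlinarith) (by positivity)
    nlinarith
  nlinarith

theorem exists_defect_eq_zero (h : TentSecond F F₁ F₂ m M) (hm : 0 < m) (hM : 0 ≤ M) :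
    ∃ b, 0 < b ∧ defect F F₁ b = 0 := by
  have hq : 0 ≤ 24 * M / m := by positivity
  set b₀ := 1 + 24 * M / m with hb₀
  have hb1 : 1 ≤ b₀ := by linarith
  have hpos : 0 < b₀⁻¹ := inv_pos.2 (by linarith)
  have n₁ := h.defect_nonpos hm hM hb₀.symm.le
  have n₂ := h.neg_comp_neg.defect_nonpos hm hM hb₀.symm.le
  -- Reflecting `F` turns the defect at `b` into minus the defect at `1/b`, so the sign flips
  -- between `b₀⁻¹` and `b₀`.
  have n₃ : 0 ≤ defect F F₁ b₀⁻¹ := by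
    simp only [defect, neg_neg, inv_inv] at n₂ ⊢
    linarith
  have hc : ContinuousOn (defect F F₁) (Set.Icc b₀⁻¹ b₀) := by
    have hinv : ContinuousOn (fun b : ℝ => b⁻¹) (Set.Icc b₀⁻¹ b₀) :=
      continuousOn_inv₀.mono fun x hx => (hpos.trans_le hx.1).ne'
    have a₁ := h.continuous_deriv.comp_continuousOn hinv.neg
    have a₂ := h.continuous.comp_continuousOn hinv.neg
    exact ((h.continuous_deriv.continuousOn.add a₁).mul (continuousOn_id.add hinv)).sub
      ((h.continuous.continuousOn.sub a₂).const_mul 2)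
  obtain ⟨b, hb, e⟩ := intermediate_value_Icc' ((inv_le_one_of_one_le₀ hb1).trans hb1) hc
    ⟨n₁, n₃⟩
  exact ⟨b, hpos.trans_le hb.1, e⟩

/-- A function with tent-shaped second derivative is dominated by a quadratic polynomial with the
same expectation under some standardized two-point law. -/
theorem exists_quadratic (h : TentSecond F F₁ F₂ m M) (hm : 0 < m) (hM : 0 ≤ M) :
    ∃ b α β γ : ℝ, 0 < b ∧ (∀ x, F x ≤ α + β * x + γ * x ^ 2) ∧ α + γ = twoPointMean F b := by
  obtain ⟨b, hb, e⟩ := h.exists_defect_eq_zero hm hM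
  obtain ⟨c, hc⟩ : ∃ c, c = b⁻¹ := ⟨_, rfl⟩
  have hbc : b * c = 1 := by rw [hc]; field_simp
  have hc0 : 0 < c := hc ▸ inv_pos.2 hb
  simp only [defect] at e
  rw [← hc] at e
  -- The quadratic is tangent to `F` at `b`; this `γ` matches the slope at `-c`, and vanishing of
  -- the defect is then exactly agreement of the values at `-c`.
  obtain ⟨γ, hγ⟩ : ∃ γ, γ = (F₁ b - F₁ (-c)) / (2 * (b + c)) := ⟨_, rfl⟩
  rw [eq_div_iff (by positivity)] at hγ
  have zc : F b + F₁ b * (-c - b) + γ * (-c - b) ^ 2 - F (-c) = 0 := by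
    linear_combination (b + c) / 2 * hγ - e / 2
  have key : ∀ x, 0 ≤ F b + F₁ b * (x - b) + γ * (x - b) ^ 2 - F x := by
    refine nonneg_of_double_zeros (D₁ := fun x => F₁ b + γ * (2 * (x - b)) - F₁ x)
      (D₂ := fun x => γ * 2 - F₂ x) (u := -c) (v := b) (fun x => ?_) (fun x => ?_) ?_ ?_
      (by linarith) hb zc (by ring) (by linear_combination -hγ) (by ring)
    · have hs := (hasDerivAt_id x).sub_const b
      exact (((((hs.const_mul (F₁ b)).const_add (F b)).add ((hs.pow 2).const_mul γ))).sub
        (h.d₁ x)).congr_deriv (by simp)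
    · have hs := (hasDerivAt_id x).sub_const b
      exact ((((hs.const_mul 2).const_mul γ).const_add (F₁ b)).sub (h.d₂ x)).congr_deriv
        (by simp)
    · intro x hx y hy hxy
      have := h.left x y hxy.le hy
      have := mul_pos hm (sub_pos.2 hxy)
      simp only; linarith
    · intro x hx y hy hxy
      have := h.right x y hx hxy.le
      have := mul_pos hm (sub_pos.2 hxy)
      simp only; linarith
  refine ⟨b, F b - F₁ b * b + γ * b ^ 2, F₁ b - 2 * γ * b, γ, hb, fun x => ?_, ?_⟩
  · linarith [key x]
  · rw [twoPointMean, ← hc, eq_div_iff (by positivity)]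
    linear_combination b ^ 2 * zc + (F₁ b * b - γ * (2 * b ^ 2 + 1 + b * c)) * hbc

end TentSecond

/-! ### The function `B` as inverse of `twoPointRho` -/

/-- The third absolute moment of a standardized two-point law with third moment `± t`. -/
noncomputable def twoPointRho (t : ℝ) : ℝ := (t ^ 2 + 2) / √(t ^ 2 + 4)

theorem sqrt_abs_sub_inv_sq_add_four {b : ℝ} (hb : 0 < b) :
    √(|b - b⁻¹| ^ 2 + 4) = b + b⁻¹ := by
  rw [sq_abs, show (b - b⁻¹) ^ 2 + 4 = (b + b⁻¹) ^ 2 by field_simp; ring]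
  exact Real.sqrt_sq (by positivity)

theorem twoPointMean_abs_pow_three {b : ℝ} (hb : 0 < b) :
    twoPointMean (fun x => |x| ^ 3) b = twoPointRho |b - b⁻¹| := by
  rw [twoPointRho, sqrt_abs_sub_inv_sq_add_four hb, sq_abs, twoPointMean, abs_neg,
    abs_of_pos hb, abs_of_pos (inv_pos.2 hb)]
  field_simp
  ring

/-- The slope of the tangent to `t` as a function of `twoPointRho t` at `T`. -/
noncomputable def tangentSlope (T : ℝ) : ℝ := √(T ^ 2 + 4) ^ 3 / (T * (T ^ 2 + 6))

theorem one_lt_tangentSlope {T : ℝ} (hT : 0 < T) : 1 < tangentSlope T := by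
  rw [tangentSlope, one_lt_div (by positivity)]
  refine lt_of_pow_lt_pow_left₀ 2 (by positivity) ?_
  rw [← pow_mul, mul_comm 3 2, pow_mul, Real.sq_sqrt (by positivity)]
  nlinarith [sq_nonneg T]

/-- Concavity of the inverse of `twoPointRho`, in tangent form. After clearing denominators and
squaring, the difference is `(t - T)²` times a polynomial with nonnegative coefficients. -/
theorem le_tangent {t T : ℝ} (ht : 0 ≤ t) (hT : 0 < T) :
    t ≤ T + tangentSlope T * (twoPointRho t - twoPointRho T) := by
  have hs : √(t ^ 2 + 4) ^ 2 = t ^ 2 + 4 := Real.sq_sqrt (by positivity)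
  have hS : √(T ^ 2 + 4) ^ 2 = T ^ 2 + 4 := Real.sq_sqrt (by positivity)
  have hs0 : 0 < √(t ^ 2 + 4) := by positivity
  have hS0 : 0 < √(T ^ 2 + 4) := by positivity
  unfold tangentSlope twoPointRho
  generalize √(t ^ 2 + 4) = s at *
  generalize √(T ^ 2 + 4) = S at *
  have key : s * (8 + T * (T ^ 2 + 6) * t) ≤ (t ^ 2 + 2) * S ^ 3 := by
    refine (sq_le_sq₀ (by positivity) (by positivity)).1 ?_
    have e₁ : (s * (8 + T * (T ^ 2 + 6) * t)) ^ 2 =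
        (t ^ 2 + 4) * (8 + T * (T ^ 2 + 6) * t) ^ 2 := by rw [mul_pow, hs]
    have e₂ : ((t ^ 2 + 2) * S ^ 3) ^ 2 = (t ^ 2 + 2) ^ 2 * (T ^ 2 + 4) ^ 3 := by
      rw [mul_pow, ← hS]; ring
    rw [e₁, e₂, ← sub_nonneg]
    have : (t ^ 2 + 2) ^ 2 * (T ^ 2 + 4) ^ 3 - (t ^ 2 + 4) * (8 + T * (T ^ 2 + 6) * t) ^ 2 =
        (t - T) ^ 2 * ((12 * T ^ 2 + 64) * t ^ 2 + (8 * T ^ 3 + 32 * T) * t +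
          4 * (T ^ 4 + 12 * T ^ 2 + 48)) := by ring
    rw [this]
    positivity
  have e : T + S ^ 3 / (T * (T ^ 2 + 6)) * ((t ^ 2 + 2) / s - (T ^ 2 + 2) / S) - t =
      ((t ^ 2 + 2) * S ^ 3 - s * (8 + T * (T ^ 2 + 6) * t)) / (T * (T ^ 2 + 6) * s) := by
    field_simp
    linear_combination (-(T ^ 2 + 2) * s) * hS
  rw [← sub_nonneg, e]
  exact div_nonneg (sub_nonneg.2 key) (by positivity)

/-- With `S = √(T² + 4)` the claim reads `S² - r S - 2 ≥ 0`, whose positive root is `(r + √(r² + 8))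
/ 2`; the radicand of `B` is the square of this root minus `4`. For `r < 1` that radicand is
negative and `B r = 0`, but the claim persists, so `r ≥ 1` need not be known. -/
theorem le_twoPointRho_of_B_lt {r T : ℝ} (hr : 0 ≤ r) (h : B r < T) : r ≤ twoPointRho T := by
  have hT : 0 < T := (Real.sqrt_nonneg _).trans_lt h
  unfold B at h
  rw [Real.sqrt_lt' hT] at h
  have hq : √(r ^ 2 + 8) ^ 2 = r ^ 2 + 8 := Real.sq_sqrt (by positivity)
  have hS : √(T ^ 2 + 4) ^ 2 = T ^ 2 + 4 := Real.sq_sqrt (by positivity)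
  have hq0 : 0 < √(r ^ 2 + 8) := by positivity
  have hS0 : 0 < √(T ^ 2 + 4) := by positivity
  unfold twoPointRho
  generalize √(r ^ 2 + 8) = q at *
  generalize √(T ^ 2 + 4) = S at *
  rw [le_div_iff₀ hS0]
  have h1 : (r + q) / 2 ≤ S := by
    refine (sq_le_sq₀ (by positivity) (by positivity)).1 ?_
    nlinarith
  have h2 : 0 ≤ (S - (r + q) / 2) * (S + (q - r) / 2) := by
    refine mul_nonneg (by linarith) ?_
    have : r ≤ q := by nlinarith
    linarith
  nlinarith

/-! ### Growth, integrability and stability of the function class -/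

section Growth

variable {E : Type*} [NormedAddCommGroup E] [NormedSpace ℝ E] {f f₁ f₂ : ℝ → E} {L : ℝ}

theorem norm_le_of_hasDerivAt_bound {g g₁ : ℝ → E} (hg : ∀ x, HasDerivAt g (g₁ x) x) {C : ℝ}
    {x : ℝ} (hC : ∀ y, |y| ≤ |x| → ‖g₁ y‖ ≤ C) : ‖g x‖ ≤ ‖g 0‖ + C * |x| := by
  have := Convex.norm_image_sub_le_of_norm_hasDerivWithin_le (s := Metric.closedBall (0 : ℝ) |x|)
    (f := g) (f' := g₁) (C := C) (x := 0) (y := x) (fun y _ => (hg y).hasDerivWithinAt)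
    (fun y hy => hC y (by simpa using hy)) (convex_closedBall _ _) (by simp) (by simp)
  rw [sub_zero, Real.norm_eq_abs] at this
  linarith [norm_sub_norm_le (g x) (g 0)]

theorem LipSecond.nonneg (h : LipSecond f f₁ f₂ L) : 0 ≤ L := by
  simpa using (norm_nonneg _).trans (h.lip 1 0)

theorem LipSecond.norm_le (h : LipSecond f f₁ f₂ L) (x : ℝ) :
    ‖f x‖ ≤ (‖f 0‖ + ‖f₁ 0‖ + ‖f₂ 0‖ + L) * (1 + |x| ^ 3) := by
  have hL := h.nonneg
  have b₂ : ∀ y, |y| ≤ |x| → ‖f₂ y‖ ≤ ‖f₂ 0‖ + L * |x| := fun y hy => by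
    have := h.lip y 0
    rw [sub_zero] at this
    have := mul_le_mul_of_nonneg_left hy hL
    linarith [norm_sub_norm_le (f₂ y) (f₂ 0)]
  have b₁ : ∀ y, |y| ≤ |x| → ‖f₁ y‖ ≤ ‖f₁ 0‖ + (‖f₂ 0‖ + L * |x|) * |x| := fun y hy => by
    refine (norm_le_of_hasDerivAt_bound h.d₂ fun z hz => b₂ z (hz.trans hy)).trans ?_
    gcongr
  have b₀ := norm_le_of_hasDerivAt_bound h.d₁ b₁
  have hx := abs_nonneg x
  have c₁ : |x| ≤ 1 + |x| ^ 3 := by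
    nlinarith [sq_nonneg (|x| - 1), mul_nonneg hx (sq_nonneg (|x| - 1))]
  have c₂ : |x| ^ 2 ≤ 1 + |x| ^ 3 := by
    nlinarith [sq_nonneg (|x| - 1), mul_nonneg hx (sq_nonneg (|x| - 1))]
  have c₀ : 0 ≤ |x| ^ 3 := by positivity
  nlinarith [mul_le_mul_of_nonneg_left c₁ (norm_nonneg (f₁ 0)),
    mul_le_mul_of_nonneg_left c₂ (norm_nonneg (f₂ 0)), mul_nonneg (norm_nonneg (f 0)) c₀]

theorem LipSecond.continuous (h : LipSecond f f₁ f₂ L) : Continuous f :=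
  continuous_iff_continuousAt.2 fun x => (h.d₁ x).continuousAt

theorem LipSecond.integrable (h : LipSecond f f₁ f₂ L) {ν : Measure ℝ} [IsProbabilityMeasure ν]
    (hR : Integrable (fun x : ℝ => |x| ^ 3) ν) : Integrable f ν :=
  (((integrable_const (1 : ℝ)).add hR).const_mul (‖f 0‖ + ‖f₁ 0‖ + ‖f₂ 0‖ + L)).mono'
    h.continuous.aestronglyMeasurable (Filter.Eventually.of_forall h.norm_le)

theorem LipSecond.comp_affine (h : LipSecond f f₁ f₂ L) (a b : ℝ) :
    LipSecond (fun x => f (a * x + b)) (fun x => a • f₁ (a * x + b))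
      (fun x => a ^ 2 • f₂ (a * x + b)) (L * |a| ^ 3) where
  d₁ x := (h.d₁ (a * x + b)).scomp x
    ((((hasDerivAt_id x).const_mul a).add_const b).congr_deriv (mul_one a))
  d₂ x := (((h.d₂ (a * x + b)).scomp x
    ((((hasDerivAt_id x).const_mul a).add_const b).congr_deriv (mul_one a))).const_smul
      a).congr_deriv (by rw [smul_smul, sq])
  lip x y := by
    rw [← smul_sub, norm_smul]
    have := h.lip (a * x + b) (a * y + b)
    rw [show a * x + b - (a * y + b) = a * (x - y) by ring, abs_mul] at this
    rw [norm_pow, Real.norm_eq_abs]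
    calc |a| ^ 2 * _ ≤ |a| ^ 2 * (L * (|a| * |x - y|)) := by gcongr
      _ = _ := by ring

theorem LipSecond.clm_comp (h : LipSecond f f₁ f₂ L) (φ : E →L[ℝ] ℝ) (hφ : ‖φ‖ ≤ 1) :
    LipSecond (fun x => φ (f x)) (fun x => φ (f₁ x)) (fun x => φ (f₂ x)) L where
  d₁ x := φ.hasFDerivAt.comp_hasDerivAt x (h.d₁ x)
  d₂ x := φ.hasFDerivAt.comp_hasDerivAt x (h.d₂ x)
  lip x y := by
    rw [← map_sub]
    exact (φ.le_of_opNorm_le hφ _).trans (by rw [one_mul]; exact h.lip x y)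

theorem LipSecond.mono (h : LipSecond f f₁ f₂ L) {L' : ℝ} (hL : L ≤ L') :
    LipSecond f f₁ f₂ L' :=
  ⟨h.d₁, h.d₂, fun x y => (h.lip x y).trans (mul_le_mul_of_nonneg_right hL (abs_nonneg _))⟩

end Growth

theorem integrable_pow {ν : Measure ℝ} [IsProbabilityMeasure ν]
    (hR : Integrable (fun x : ℝ => |x| ^ 3) ν) {k : ℕ} (hk : k ≤ 3) :
    Integrable (fun x : ℝ => x ^ k) ν := by
  refine ((integrable_const (1 : ℝ)).add hR).mono' (by fun_prop)
    (Filter.Eventually.of_forall fun x => ?_)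
  rw [norm_pow, Real.norm_eq_abs]
  simp only [Pi.add_apply]
  have h0 := abs_nonneg x
  rcases le_total |x| 1 with h | h
  · have := pow_le_one₀ (n := k) h0 h
    have : 0 ≤ |x| ^ 3 := by positivity
    linarith
  · have := pow_le_pow_right₀ h hk
    linarith

/-! ### Comparison for a single standardized law -/

/-- One-sided comparison of a standardized law with the symmetric two-point law. -/
theorem LipSecond.integral_sub_le {f f₁ f₂ : ℝ → ℝ} {L : ℝ} (h : LipSecond f f₁ f₂ L)
    (hL : 0 < L) {ν : Measure ℝ} [IsProbabilityMeasure ν]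
    (hR : Integrable (fun x : ℝ => |x| ^ 3) ν) (h1 : ∫ x, x ∂ν = 0) (h2 : ∫ x, x ^ 2 ∂ν = 1)
    {T : ℝ} (hT : 0 < T) (h3 : ∫ x, |x| ^ 3 ∂ν ≤ twoPointRho T) :
    ∫ x, f x ∂ν - (f 1 + f (-1)) / 2 ≤ L / 6 * T := by
  set lam := tangentSlope T with hlam
  have hlam1 : 1 < lam := one_lt_tangentSlope hT
  -- The kink `L * lam * |x|` outweighs the `L`-Lipschitz `f₂` because `lam > 1`; this leaves the
  -- slope `L * (lam - 1)` on each side.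
  have tent : TentSecond (fun x => f x - L * lam / 6 * |x| ^ 3)
      (fun x => f₁ x - L * lam / 2 * (x * |x|)) (fun x => f₂ x - L * lam * |x|)
      (L * (lam - 1)) (L * (lam + 1)) := by
    constructor
    · intro x
      exact ((h.d₁ x).sub ((hasDerivAt_abs_pow_three x).const_mul _)).congr_deriv (by ring)
    · intro x
      exact ((h.d₂ x).sub ((hasDerivAt_mul_abs x).const_mul _)).congr_deriv (by ring)
    · intro x y hx hy
      have := (le_abs_self _).trans (h.lip y x)
      rw [abs_of_nonneg (sub_nonneg.2 hy)] at this
      rw [abs_of_nonneg hx, abs_of_nonneg (hx.trans hy)]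
      linarith
    · intro x y hx hy
      have := (neg_le_abs _).trans (h.lip y x)
      rw [abs_of_nonneg (sub_nonneg.2 hx)] at this
      rw [abs_of_nonpos hy, abs_of_nonpos (hx.trans hy)]
      linarith
    · intro x y
      have i₁ : |f₂ x - f₂ y| ≤ L * |x - y| := h.lip x y
      have i₂ : |L * lam * (|x| - |y|)| ≤ L * lam * |x - y| := by
        rw [abs_mul, abs_of_pos (by positivity)]
        exact mul_le_mul_of_nonneg_left (abs_abs_sub_abs_le_abs_sub x y) (by positivity)
      calc |f₂ x - L * lam * |x| - (f₂ y - L * lam * |y|)|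
          = |(f₂ x - f₂ y) - L * lam * (|x| - |y|)| := by congr 1; ring
        _ ≤ |f₂ x - f₂ y| + |L * lam * (|x| - |y|)| := abs_sub _ _
        _ ≤ _ := by linarith
  obtain ⟨b, α, β, γ, hb, hle, he⟩ := tent.exists_quadratic
    (mul_pos hL (by linarith)) (by positivity)
  have p1 : Integrable (fun x : ℝ => x) ν := by simpa using integrable_pow hR (k := 1) (by norm_num)
  have p2 : Integrable (fun x : ℝ => x ^ 2) ν := integrable_pow hR (by norm_num)
  have fi := h.integrable hR
  have i₁ : ∫ x, f x ∂ν - L * lam / 6 * ∫ x, |x| ^ 3 ∂ν ≤ α + γ := by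
    rw [← integral_const_mul, ← integral_sub fi (hR.const_mul _)]
    refine (integral_mono (fi.sub (hR.const_mul _))
      (((integrable_const α).add (p1.const_mul β)).add (p2.const_mul γ)) hle).trans_eq ?_
    have pa : Integrable (fun x => α + β * x) ν := (integrable_const α).add (p1.const_mul β)
    simp only [Pi.add_apply]
    rw [integral_add pa (p2.const_mul γ),
      integral_add (integrable_const α) (p1.const_mul β), integral_const_mul, integral_const_mul,
      h1, h2]
    simp
  have e : twoPointMean (fun x => f x - L * lam / 6 * |x| ^ 3) b =
      twoPointMean f b - L * lam / 6 * twoPointRho |b - b⁻¹| := by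
    rw [← twoPointMean_abs_pow_three hb]
    unfold twoPointMean; ring
  rw [he, e] at i₁
  have i₂ := h.twoPointMean_sub_le hb
  -- The multiplier `lam` is the tangent slope at `T`, so the terms in `twoPointRho |b - b⁻¹|`
  -- cancel and the unknown `b` disappears.
  have i₃ := mul_le_mul_of_nonneg_left (le_tangent (abs_nonneg (b - b⁻¹)) hT)
    (show 0 ≤ L / 6 by positivity)
  have i₄ := mul_le_mul_of_nonneg_left h3 (show 0 ≤ L * lam / 6 by positivity)
  rw [← hlam] at i₃
  linarith

/-- Comparison of a standardized law with the symmetric two-point law on `{-1, 1}`. -/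
theorem LipSecond.norm_integral_sub_le {E : Type*} [NormedAddCommGroup E] [NormedSpace ℝ E]
    [CompleteSpace E] {f f₁ f₂ : ℝ → E} {L : ℝ} (h : LipSecond f f₁ f₂ L)
    {ν : Measure ℝ} [IsProbabilityMeasure ν]
    (hR : Integrable (fun x : ℝ => |x| ^ 3) ν) (h1 : ∫ x, x ∂ν = 0) (h2 : ∫ x, x ^ 2 ∂ν = 1) :
    ‖∫ x, f x ∂ν - (2⁻¹ : ℝ) • (f (-1) + f 1)‖ ≤ L / 6 * B (∫ x, |x| ^ 3 ∂ν) := by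
  set r := ∫ x, |x| ^ 3 ∂ν with hr
  have hr0 : 0 ≤ r := integral_nonneg fun x => by positivity
  -- The one-sided bound needs `L > 0` and `T > 0`, while `L` and `B r` may vanish; both are
  -- enlarged by `ε`.
  have hlim : Filter.Tendsto (fun ε : ℝ => (L + ε) / 6 * (B r + ε)) (nhdsWithin 0 (Set.Ioi 0))
      (nhds (L / 6 * B r)) := by
    have : Continuous fun ε : ℝ => (L + ε) / 6 * (B r + ε) := by fun_prop
    have := this.tendsto 0
    simp only [add_zero] at this
    exact this.mono_left nhdsWithin_le_nhds
  refine ge_of_tendsto hlim ?_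
  filter_upwards [self_mem_nhdsWithin] with ε hε
  have hε : 0 < ε := hε
  obtain ⟨φ, hφ, he⟩ := exists_dual_vector'' ℝ (∫ x, f x ∂ν - (2⁻¹ : ℝ) • (f (-1) + f 1))
  have hB : 0 ≤ B r := Real.sqrt_nonneg _
  have := ((h.clm_comp φ hφ).mono (show L ≤ L + ε by linarith)).integral_sub_le
    (by linarith [h.nonneg]) hR h1 h2 (show 0 < B r + ε by linarith)
    (le_twoPointRho_of_B_lt hr0 (by linarith))
  rw [φ.integral_comp_comm (h.integrable hR)] at this
  simp only [map_sub, map_smul, map_add, smul_eq_mul] at he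
  simp only [RCLike.ofReal_real_eq_id, id] at he
  rw [← he]
  linarith

/-! ### Convolutions, replacement of summands, additivity of moments -/

section Convolution

theorem isProbabilityMeasure_convolution {n : ℕ} (P : Fin n → Measure ℝ)
    [∀ i, IsProbabilityMeasure (P i)] : IsProbabilityMeasure (convolution P) :=
  Measure.isProbabilityMeasure_map (by fun_prop)

theorem convolution_zero (P : Fin 0 → Measure ℝ) : convolution P = Measure.dirac 0 := by
  rw [convolution, Measure.pi_of_empty]
  exact (Measure.map_dirac' (by fun_prop) _).trans (by simp)

theorem convolution_succ {n : ℕ} (P : Fin (n + 1) → Measure ℝ)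
    [∀ i, IsProbabilityMeasure (P i)] :
    convolution P = (P 0).conv (convolution fun i => P i.succ) := by
  have h := (measurePreserving_piFinSuccAbove P 0).map_eq
  have e : (P 0).prod (convolution fun i => P i.succ) =
      ((P 0).prod (Measure.pi fun i : Fin n => P i.succ)).map
        (Prod.map id fun x => ∑ i, x i) := by
    rw [← Measure.map_prod_map _ _ measurable_id (by fun_prop), Measure.map_id]; rfl
  rw [Measure.conv, e, Measure.map_map (by fun_prop) (by fun_prop)]
  simp only [Fin.zero_succAbove] at h
  rw [← h, Measure.map_map (by fun_prop) (MeasurableEquiv.measurable _), convolution]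
  congr 1
  funext x
  simp [Fin.sum_univ_succ, Fin.tail]

theorem convolution_map_affine {n : ℕ} (P : Fin n → Measure ℝ)
    [∀ i, IsProbabilityMeasure (P i)] (a : ℝ) (b : Fin n → ℝ) :
    (convolution fun i => (P i).map fun x => a * x + b i) =
      (convolution P).map fun x => a * x + ∑ i, b i := by
  have (i : Fin n) : IsProbabilityMeasure ((P i).map fun x => a * x + b i) :=
    Measure.isProbabilityMeasure_map (by fun_prop)
  rw [convolution, convolution, ← Measure.pi_map_pi (fun i => by fun_prop),
    Measure.map_map (by fun_prop) (by fun_prop), Measure.map_map (by fun_prop) (by fun_prop)]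
  congr 1
  funext x
  simp [Finset.sum_add_distrib, Finset.mul_sum]

theorem integrable_abs_pow_three_conv {μ ν : Measure ℝ} [IsProbabilityMeasure μ]
    [IsProbabilityMeasure ν] (hμ : Integrable (fun x : ℝ => |x| ^ 3) μ)
    (hν : Integrable (fun x : ℝ => |x| ^ 3) ν) :
    Integrable (fun x : ℝ => |x| ^ 3) (μ.conv ν) := by
  rw [Measure.conv, integrable_map_measure (by fun_prop) (by fun_prop)]
  refine (((hμ.comp_fst ν).add (hν.comp_snd μ)).const_mul 4).mono' (by fun_prop)
    (Filter.Eventually.of_forall fun z => ?_)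
  simp only [Function.comp_apply, norm_pow, Real.norm_eq_abs, abs_abs, Pi.add_apply]
  refine (pow_le_pow_left₀ (abs_nonneg _) (abs_add_le z.1 z.2) 3).trans ?_
  have hx := abs_nonneg z.1
  have hy := abs_nonneg z.2
  nlinarith [mul_nonneg (add_nonneg hx hy) (sq_nonneg (|z.1| - |z.2|))]

theorem norm_integral_conv_sub_le {E : Type*} [NormedAddCommGroup E] [NormedSpace ℝ E]
    {μ ν₁ ν₂ : Measure ℝ} [IsProbabilityMeasure μ] [IsProbabilityMeasure ν₁]
    [IsProbabilityMeasure ν₂] {g : ℝ → E} (h₁ : Integrable g (μ.conv ν₁))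
    (h₂ : Integrable g (μ.conv ν₂)) {K : ℝ}
    (hK : ∀ x, ‖∫ y, g (x + y) ∂ν₁ - ∫ y, g (x + y) ∂ν₂‖ ≤ K) :
    ‖∫ x, g x ∂(μ.conv ν₁) - ∫ x, g x ∂(μ.conv ν₂)‖ ≤ K := by
  rw [integral_conv h₁, integral_conv h₂, ← integral_sub]
  · simpa using norm_integral_le_of_norm_le_const (μ := μ) (Filter.Eventually.of_forall hK)
  · exact ((integrable_map_measure h₁.1 (by fun_prop)).1 h₁).integral_prod_left
  · exact ((integrable_map_measure h₂.1 (by fun_prop)).1 h₂).integral_prod_left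

theorem LipSecond.comp_add_left {E : Type*} [NormedAddCommGroup E] [NormedSpace ℝ E]
    {g g₁ g₂ : ℝ → E} {L : ℝ} (h : LipSecond g g₁ g₂ L) (x : ℝ) :
    LipSecond (fun y => g (x + y)) (fun y => g₁ (x + y)) (fun y => g₂ (x + y)) L := by
  simpa [add_comm] using h.comp_affine 1 x

theorem integrable_abs_pow_three_convolution {n : ℕ} {P : Fin n → Measure ℝ}
    [∀ i, IsProbabilityMeasure (P i)] (hP : ∀ i, Integrable (fun x : ℝ => |x| ^ 3) (P i)) :
    Integrable (fun x : ℝ => |x| ^ 3) (convolution P) := by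
  induction n with
  | zero => rw [convolution_zero]; exact integrable_dirac (by simp)
  | succ n ih =>
    have := isProbabilityMeasure_convolution fun i => P (Fin.succ i)
    rw [convolution_succ]
    exact integrable_abs_pow_three_conv (hP 0) (ih fun i => hP i.succ)

/-- Summation of one-by-one replacement errors in a convolution. -/
theorem norm_integral_convolution_sub_le {E : Type*} [NormedAddCommGroup E] [NormedSpace ℝ E]
    {n : ℕ} {P Q : Fin n → Measure ℝ}
    [∀ i, IsProbabilityMeasure (P i)] [∀ i, IsProbabilityMeasure (Q i)]
    (hP : ∀ i, Integrable (fun x : ℝ => |x| ^ 3) (P i))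
    (hQ : ∀ i, Integrable (fun x : ℝ => |x| ^ 3) (Q i)) {L : ℝ} {c : Fin n → ℝ}
    (hc : ∀ i (g g₁ g₂ : ℝ → E), LipSecond g g₁ g₂ L →
      ‖∫ x, g x ∂(P i) - ∫ x, g x ∂(Q i)‖ ≤ c i) {g g₁ g₂ : ℝ → E} (hg : LipSecond g g₁ g₂ L) :
    ‖∫ x, g x ∂(convolution P) - ∫ x, g x ∂(convolution Q)‖ ≤ ∑ i, c i := by
  induction n generalizing g g₁ g₂ with
  | zero => simp [convolution_zero]
  | succ n ih =>
    have := isProbabilityMeasure_convolution fun i => P (Fin.succ i)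
    have := isProbabilityMeasure_convolution fun i => Q (Fin.succ i)
    have iP := integrable_abs_pow_three_convolution fun i : Fin n => hP i.succ
    have iQ := integrable_abs_pow_three_convolution fun i : Fin n => hQ i.succ
    have a₁ := hg.integrable (integrable_abs_pow_three_conv (hP 0) iP)
    have a₂ := hg.integrable (integrable_abs_pow_three_conv (hQ 0) iP)
    have a₃ := hg.integrable (integrable_abs_pow_three_conv (hQ 0) iQ)
    -- The intermediate law is `Q 0` convolved with the remaining `P i`. Commutativity puts the
    -- common factor first, where it is averaged out.
    have b₁ := norm_integral_conv_sub_le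
      (by rw [Measure.conv_comm (P 0)] at a₁; exact a₁)
      (by rw [Measure.conv_comm (Q 0)] at a₂; exact a₂)
      fun x => hc 0 _ _ _ (hg.comp_add_left x)
    have b₂ := norm_integral_conv_sub_le a₂ a₃ fun x =>
      ih (fun i => hP i.succ) (fun i => hQ i.succ) (fun i => hc i.succ) (hg.comp_add_left x)
    rw [Measure.conv_comm _ (P 0), Measure.conv_comm _ (Q 0)] at b₁
    rw [convolution_succ P, convolution_succ Q, Fin.sum_univ_succ]
    exact (norm_sub_le_norm_sub_add_norm_sub _ _ _).trans (add_le_add b₁ b₂)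

/-- Centred laws with finite third absolute moment. -/
structure Centred (ν : Measure ℝ) : Prop where
  isProb : IsProbabilityMeasure ν
  moment : Integrable (fun x : ℝ => |x| ^ 3) ν
  mean_zero : ∫ x, x ∂ν = 0

theorem Centred.conv {μ ν : Measure ℝ} (hμ : Centred μ) (hν : Centred ν) :
    Centred (μ.conv ν) ∧ (∫ x, x ^ 2 ∂(μ.conv ν) = ∫ x, x ^ 2 ∂μ + ∫ x, x ^ 2 ∂ν) ∧
      ∫ x, x ^ 3 ∂(μ.conv ν) = ∫ x, x ^ 3 ∂μ + ∫ x, x ^ 3 ∂ν := by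
  have := hμ.isProb
  have := hν.isProb
  have hc := integrable_abs_pow_three_conv hμ.moment hν.moment
  have p1 : ∀ {ν : Measure ℝ}, Centred ν → Integrable (fun x : ℝ => x) ν := fun h => by
    have := h.isProb
    simpa using integrable_pow h.moment (k := 1) (by norm_num)
  have p2 : ∀ {ν : Measure ℝ}, Centred ν → Integrable (fun x : ℝ => x ^ 2) ν := fun h => by
    have := h.isProb
    exact integrable_pow h.moment (by norm_num)
  have p3 : ∀ {ν : Measure ℝ}, Centred ν → Integrable (fun x : ℝ => x ^ 3) ν := fun h => by
    have := h.isProb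
    exact integrable_pow h.moment (by norm_num)
  refine ⟨⟨inferInstance, hc, ?_⟩, ?_, ?_⟩
  · rw [integral_conv (by simpa using integrable_pow hc (k := 1) (by norm_num))]
    have (x : ℝ) : ∫ y, (x + y) ∂ν = x := by
      rw [integral_add (integrable_const _) (p1 hν), hν.mean_zero]; simp
    simp_rw [this, hμ.mean_zero]
  · rw [integral_conv (integrable_pow hc (by norm_num))]
    have (x : ℝ) : ∫ y, (x + y) ^ 2 ∂ν = x ^ 2 + ∫ y, y ^ 2 ∂ν := by
      have e : ∀ y, (x + y) ^ 2 = x ^ 2 + 2 * x * y + y ^ 2 := fun y => by ring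
      have i₁ : Integrable (fun y => x ^ 2 + 2 * x * y) ν :=
        (integrable_const _).add ((p1 hν).const_mul _)
      simp_rw [e]
      rw [integral_add i₁ (p2 hν), integral_add (integrable_const _) ((p1 hν).const_mul _),
        integral_const_mul, hν.mean_zero]
      simp
    simp_rw [this]
    rw [integral_add (p2 hμ) (integrable_const _)]
    simp
  · rw [integral_conv (integrable_pow hc (by norm_num))]
    have (x : ℝ) : ∫ y, (x + y) ^ 3 ∂ν =
        x ^ 3 + (3 * ∫ y, y ^ 2 ∂ν) * x + ∫ y, y ^ 3 ∂ν := by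
      have e : ∀ y, (x + y) ^ 3 = x ^ 3 + 3 * x ^ 2 * y + 3 * x * y ^ 2 + y ^ 3 :=
        fun y => by ring
      have i₁ : Integrable (fun y => x ^ 3 + 3 * x ^ 2 * y) ν :=
        (integrable_const _).add ((p1 hν).const_mul _)
      have i₂ : Integrable (fun y => x ^ 3 + 3 * x ^ 2 * y + 3 * x * y ^ 2) ν :=
        i₁.add ((p2 hν).const_mul _)
      simp_rw [e]
      rw [integral_add i₂ (p3 hν), integral_add i₁ ((p2 hν).const_mul _),
        integral_add (integrable_const _) ((p1 hν).const_mul _),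
        integral_const_mul, integral_const_mul, hν.mean_zero]
      simp; ring
    simp_rw [this]
    have i₁ : Integrable (fun x => x ^ 3 + (3 * ∫ y, y ^ 2 ∂ν) * x) μ :=
      (p3 hμ).add ((p1 hμ).const_mul _)
    rw [integral_add i₁ (integrable_const _), integral_add (p3 hμ) ((p1 hμ).const_mul _),
      integral_const_mul, hμ.mean_zero]
    simp

theorem Centred.convolution {n : ℕ} {P : Fin n → Measure ℝ} (hP : ∀ i, Centred (P i)) :
    Centred (convolution P) ∧ (∫ x, x ^ 2 ∂(convolution P) = ∑ i, ∫ x, x ^ 2 ∂(P i)) ∧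
      ∫ x, x ^ 3 ∂(RademacherApprox.convolution P) = ∑ i, ∫ x, x ^ 3 ∂(P i) := by
  induction n with
  | zero =>
    rw [convolution_zero]
    exact ⟨⟨inferInstance, integrable_dirac (by simp), by simp⟩, by simp, by simp⟩
  | succ n ih =>
    have (i : Fin (n + 1)) := (hP i).isProb
    obtain ⟨h₁, h₂, h₃⟩ := ih fun i => hP i.succ
    obtain ⟨k₁, k₂, k₃⟩ := (hP 0).conv h₁
    rw [convolution_succ, Fin.sum_univ_succ, Fin.sum_univ_succ]
    exact ⟨k₁, by rw [k₂, h₂], by rw [k₃, h₃]⟩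

end Convolution

/-! ### Standardization and affine maps -/

section Standardization

theorem mean_map_affine {ν : Measure ℝ} [IsProbabilityMeasure ν]
    (h : Integrable (fun x : ℝ => x) ν) (a b : ℝ) :
    mean (ν.map fun x => a * x + b) = a * mean ν + b := by
  rw [mean, integral_map (by fun_prop) (by fun_prop),
    integral_add (h.const_mul a) (integrable_const b), integral_const_mul, mean]
  simp

theorem sd_map_affine {ν : Measure ℝ} [IsProbabilityMeasure ν] (a b : ℝ) :
    sd (ν.map fun x => a * x + b) = |a| * sd ν := by
  rw [sd, variance_map (by fun_prop) (by fun_prop), sd, ← Real.sqrt_sq_eq_abs,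
    ← Real.sqrt_mul (sq_nonneg a)]
  congr 1
  change Var[fun x => a * x + b; ν] = _
  rw [variance_add_const (by fun_prop), variance_const_mul]
  rfl

theorem standardize_map_affine {ν : Measure ℝ} [IsProbabilityMeasure ν]
    (h : Integrable (fun x : ℝ => x) ν) {a : ℝ} (ha : 0 < a) (b : ℝ) :
    standardize (ν.map fun x => a * x + b) = standardize ν := by
  rw [standardize, mean_map_affine h, sd_map_affine, abs_of_pos ha,
    Measure.map_map (by fun_prop) (by fun_prop), standardize]
  congr 1
  funext x
  simp only [Function.comp_apply]
  rw [show a * x + b - (a * mean ν + b) = a * (x - mean ν) by ring, mul_div_mul_left _ _ ha.ne']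

theorem sd_sq {ν : Measure ℝ} : sd ν ^ 2 = ∫ x, (x - mean ν) ^ 2 ∂ν := by
  rw [sd, Real.sq_sqrt (variance_nonneg _ _), variance_eq_integral (by fun_prop)]
  rfl

theorem Centred.standardize_eq {ν : Measure ℝ} (h : Centred ν) :
    standardize ν = ν.map fun x => (√(∫ x, x ^ 2 ∂ν))⁻¹ * x := by
  have hm : mean ν = 0 := h.mean_zero
  have hs : sd ν = √(∫ x, x ^ 2 ∂ν) := by
    rw [← Real.sqrt_sq (show 0 ≤ sd ν from Real.sqrt_nonneg _), sd_sq, hm]; simp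
  rw [standardize, hm, hs]
  simp_rw [sub_zero, div_eq_inv_mul]

end Standardization

/-! ### Two-point laws -/

section TwoPoint

theorem integrable_two_diracs {E : Type*} [NormedAddCommGroup E] (f : ℝ → E) (a b : ℝ)
    {p q : ENNReal} (hp : p ≠ ⊤) (hq : q ≠ ⊤) :
    Integrable f (p • Measure.dirac a + q • Measure.dirac b) :=
  ((integrable_dirac (by simp)).smul_measure hp).add_measure
    ((integrable_dirac (by simp)).smul_measure hq)

theorem integral_two_diracs {E : Type*} [NormedAddCommGroup E] [NormedSpace ℝ E]
    [CompleteSpace E] (f : ℝ → E) (a b : ℝ) {p q : ENNReal} (hp : p ≠ ⊤) (hq : q ≠ ⊤) :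
    ∫ x, f x ∂(p • Measure.dirac a + q • Measure.dirac b) = p.toReal • f a + q.toReal • f b := by
  rw [integral_add_measure ((integrable_dirac (by simp)).smul_measure hp)
    ((integrable_dirac (by simp)).smul_measure hq), integral_smul_measure, integral_smul_measure,
    integral_dirac, integral_dirac]

theorem integral_symTwoPoint {E : Type*} [NormedAddCommGroup E] [NormedSpace ℝ E]
    [CompleteSpace E] (f : ℝ → E) (s : ℝ) :
    ∫ x, f x ∂(symTwoPoint s) = (2⁻¹ : ℝ) • (f (-s) + f s) := by
  rw [symTwoPoint, smul_add, integral_two_diracs f _ _ (by simp) (by simp), smul_add]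
  simp

theorem isProbabilityMeasure_half_diracs (a b : ℝ) :
    IsProbabilityMeasure ((2⁻¹ : ENNReal) • (Measure.dirac a + Measure.dirac b)) := by
  constructor
  simp only [Measure.smul_apply, Measure.add_apply, measure_univ, smul_eq_mul]
  rw [one_add_one_eq_two, ENNReal.inv_mul_cancel (by simp) (by simp)]

theorem centred_symTwoPoint (s : ℝ) : Centred (symTwoPoint s) where
  isProb := isProbabilityMeasure_half_diracs _ _
  moment := by
    rw [symTwoPoint, smul_add]
    exact integrable_two_diracs _ _ _ (by simp) (by simp)
  mean_zero := by rw [integral_symTwoPoint]; simp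

theorem symTwoPoint_eq_map (s : ℝ) : symTwoPoint s =
    ((2⁻¹ : ENNReal) • (Measure.dirac (0 : ℝ) + Measure.dirac 1)).map fun x : ℝ => 2 * s * x + -s := by
  rw [Measure.map_smul, Measure.map_add _ _ (by fun_prop), Measure.map_dirac' (by fun_prop),
    Measure.map_dirac' (by fun_prop), symTwoPoint]
  congr 4 <;> ring

/-- For two-point laws `B` recovers the absolute centred third moment. -/
theorem IsTwoPoint.sd_pow_mul_B {P : Measure ℝ} (h : IsTwoPoint P) :
    sd P ^ 3 * B (rho P) = |centredThird P| := by
  obtain ⟨a, b, p, hab, hp, hp1, rfl⟩ := h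
  obtain ⟨q, hq⟩ : ∃ q, q = 1 - p := ⟨_, rfl⟩
  have hq0 : 0 < q := by linarith
  have int (f : ℝ → ℝ) : ∫ x, f x ∂(ENNReal.ofReal p • Measure.dirac a +
      ENNReal.ofReal (1 - p) • Measure.dirac b) = p * f a + q * f b := by
    rw [integral_two_diracs f _ _ (by simp) (by simp), ENNReal.toReal_ofReal hp.le,
      ENNReal.toReal_ofReal (by linarith), hq, smul_eq_mul, smul_eq_mul]
  set P := ENNReal.ofReal p • Measure.dirac a + ENNReal.ofReal (1 - p) • Measure.dirac b
  have hm : mean P = p * a + q * b := int _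
  have ha : a - mean P = q * (a - b) := by rw [hm, hq]; ring
  have hb : b - mean P = -(p * (a - b)) := by rw [hm, hq]; ring
  set d := a - b
  have hd : 0 < |d| := abs_pos.2 (sub_ne_zero.2 hab)
  set w := √(p * q) with hw
  have hw0 : 0 < w := Real.sqrt_pos.2 (by positivity)
  have hw2 : w ^ 2 = p * q := Real.sq_sqrt (by positivity)
  have hs : sd P = w * |d| := by
    have : sd P ^ 2 = (w * |d|) ^ 2 := by
      rw [sd_sq, int, ha, hb, mul_pow w, hw2, sq_abs, hq]; ring
    exact (pow_left_inj₀ (Real.sqrt_nonneg _) (by positivity) two_ne_zero).1 this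
  -- In terms of `w = √(pq)`, `rho² + 8` is the perfect square of `w⁻¹ + 2 * w`, which removes the
  -- inner root of `B`.
  have hr : rho P = w⁻¹ - 2 * w := by
    rw [rho, int, ha, hb, hs, abs_div, abs_div, abs_neg, abs_of_pos (mul_pos hw0 hd), abs_mul,
      abs_mul, abs_of_pos hp, abs_of_pos hq0]
    have hwe : w⁻¹ - 2 * w = (1 - 2 * w ^ 2) * w ^ 2 / w ^ 3 := by field_simp
    rw [hwe, hw2]
    field_simp
    rw [hq]
    ring
  have hB : B (rho P) = |q - p| / w := by
    have e : √(rho P ^ 2 + 8) = w⁻¹ + 2 * w := by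
      rw [hr, show (w⁻¹ - 2 * w) ^ 2 + 8 = (w⁻¹ + 2 * w) ^ 2 by field_simp; ring]
      exact Real.sqrt_sq (by positivity)
    rw [B, e, hr]
    rw [← Real.sqrt_sq (show 0 ≤ |q - p| / w by positivity)]
    congr 1
    have e2 : (q - p) ^ 2 = 1 - 4 * w ^ 2 := by rw [hw2, hq]; ring
    rw [div_pow, sq_abs, e2]
    field_simp
    ring
  have hc : centredThird P = w ^ 2 * (q - p) * d ^ 3 := by
    rw [centredThird, int, ha, hb, hw2, hq]; ring
  rw [hs, hB, hc, abs_mul, abs_mul, abs_pow, abs_pow, abs_of_pos hw0]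
  field_simp

end TwoPoint

/-! ### Centred summands and standardized convolutions -/

/-- The law `P` centred at its mean. -/
noncomputable def centre (P : Measure ℝ) : Measure ℝ := P.map fun x => 1 * x + -mean P

namespace IsP3

variable {P : Measure ℝ}

theorem integrable_id (h : IsP3 P) : Integrable (fun x : ℝ => x) P := by
  have := h.isProb
  simpa using integrable_pow h.moment (k := 1) (by norm_num)

theorem integrable_abs_affine (h : IsP3 P) (a b : ℝ) :
    Integrable (fun x : ℝ => |a * x + b| ^ 3) P := by
  have := h.isProb
  refine ((((h.moment.const_mul (|a| ^ 3)).add (integrable_const (|b| ^ 3))).const_mul 4)).mono'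
    (by fun_prop) (Filter.Eventually.of_forall fun x => ?_)
  simp only [norm_pow, Real.norm_eq_abs, abs_abs, Pi.add_apply]
  refine (pow_le_pow_left₀ (abs_nonneg _) (abs_add_le _ _) 3).trans ?_
  rw [abs_mul, ← mul_pow]
  have hx : 0 ≤ |a| * |x| := by positivity
  have hy := abs_nonneg b
  nlinarith [mul_nonneg (add_nonneg hx hy) (sq_nonneg (|a| * |x| - |b|))]

theorem centred_centre (h : IsP3 P) : Centred (centre P) := by
  have := h.isProb
  refine ⟨Measure.isProbabilityMeasure_map (by fun_prop), ?_, ?_⟩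
  · rw [centre, integrable_map_measure (by fun_prop) (by fun_prop)]
    exact h.integrable_abs_affine 1 _
  · exact (mean_map_affine h.integrable_id 1 _).trans (by ring)

theorem integral_centre {E : Type*} [NormedAddCommGroup E] [NormedSpace ℝ E] {g : ℝ → E}
    (hg : Continuous g) : ∫ x, g x ∂(centre P) = ∫ x, g (x - mean P) ∂P := by
  rw [centre, integral_map (by fun_prop) hg.aestronglyMeasurable]
  simp_rw [one_mul, ← sub_eq_add_neg]

/-- The single-law comparison applied to `x ↦ g (sd P * x)`, whose Lipschitz constant picks up the
factor `sd P ^ 3`. -/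
theorem norm_integral_centre_sub_le {E : Type*} [NormedAddCommGroup E] [NormedSpace ℝ E]
    [CompleteSpace E] (h : IsP3 P) {g g₁ g₂ : ℝ → E} {L : ℝ} (hg : LipSecond g g₁ g₂ L) :
    ‖∫ x, g x ∂(centre P) - ∫ x, g x ∂(symTwoPoint (sd P))‖
      ≤ L / 6 * (sd P ^ 3 * B (rho P)) := by
  have := h.isProb
  have hs := h.sd_pos
  have hstd : standardize P = P.map fun x => (sd P)⁻¹ * x + -((sd P)⁻¹ * mean P) := by
    rw [standardize]; congr 1; funext x; ring
  have : IsProbabilityMeasure (standardize P) := by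
    rw [standardize]; exact Measure.isProbabilityMeasure_map (by fun_prop)
  have m3 : Integrable (fun x : ℝ => |x| ^ 3) (standardize P) := by
    rw [hstd, integrable_map_measure (by fun_prop) (by fun_prop)]
    exact h.integrable_abs_affine _ _
  have m1 : ∫ x, x ∂(standardize P) = 0 := by
    rw [hstd]
    exact (mean_map_affine h.integrable_id _ _).trans (by ring)
  have m2 : ∫ x, x ^ 2 ∂(standardize P) = 1 := by
    rw [standardize, integral_map (by fun_prop) (by fun_prop)]
    simp_rw [div_pow]
    rw [integral_div, ← sd_sq, div_self (by positivity)]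
  have hr : ∫ x, |x| ^ 3 ∂(standardize P) = rho P := by
    rw [standardize, integral_map (by fun_prop) (by fun_prop), rho]
  have key := (hg.comp_affine (sd P) 0).norm_integral_sub_le m3 m1 m2
  simp only [add_zero] at key
  rw [hr, abs_of_pos hs, mul_neg, mul_one] at key
  rw [integral_centre hg.continuous, integral_symTwoPoint]
  have e : ∫ x, g (sd P * x) ∂(standardize P) = ∫ x, g (x - mean P) ∂P := by
    have hc := hg.continuous
    rw [standardize, integral_map (by fun_prop)
      (Continuous.aestronglyMeasurable (by fun_prop))]
    simp_rw [mul_div_cancel₀ _ hs.ne']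
  rw [e] at key
  exact key.trans_eq (by ring)

end IsP3

/-- Puts the law in the form of one common scaling of a convolution of centred laws. The symmetric
comparison law has the same variances, hence the same scaling, so only the convolutions need
comparing. -/
theorem IsP3.standardize_convolution {n : ℕ} {P : Fin n → Measure ℝ} (hP : ∀ i, IsP3 (P i)) :
    standardize (convolution P) =
      (convolution fun i => centre (P i)).map fun x => (√(∑ i, sd (P i) ^ 2))⁻¹ * x := by
  have (i : Fin n) := (hP i).isProb
  have := isProbabilityMeasure_convolution P
  have hi : Integrable (fun x : ℝ => x) (convolution P) := by
    simpa using integrable_pow (integrable_abs_pow_three_convolution fun i => (hP i).moment)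
      (k := 1) (by norm_num)
  obtain ⟨h₁, h₂, -⟩ := Centred.convolution fun i => (hP i).centred_centre
  have e := h₁.standardize_eq
  rw [h₂] at e
  have e₂ (i : Fin n) : ∫ x, x ^ 2 ∂(centre (P i)) = sd (P i) ^ 2 := by
    rw [IsP3.integral_centre (by fun_prop), sd_sq]
  simp_rw [e₂] at e
  rw [← e]
  simp only [centre]
  rw [convolution_map_affine, standardize_map_affine hi one_pos]

theorem standardize_convolution_symTwoPoint {n : ℕ} (s : Fin n → ℝ) :
    standardize (convolution fun i => symTwoPoint (s i)) =
      (convolution fun i => symTwoPoint (s i)).map fun x => (√(∑ i, s i ^ 2))⁻¹ * x := by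
  obtain ⟨h₁, h₂, -⟩ := Centred.convolution fun i => centred_symTwoPoint (s i)
  rw [h₁.standardize_eq, h₂]
  have (i : Fin n) : ∫ x, x ^ 2 ∂(symTwoPoint (s i)) = s i ^ 2 := by
    rw [integral_symTwoPoint]; simp; ring
  simp_rw [this]

/-! ### The class `C^{2,1}` and cubes -/

section Smooth

variable {E : Type*} [NormedAddCommGroup E] [NormedSpace ℝ E]

theorem IsC21.lipSecond {f : ℝ → E} (hf : IsC21 f) :
    LipSecond f (deriv f) (iteratedDeriv 2 f) (lipNorm (iteratedDeriv 2 f)) where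
  d₁ x := (hf.1.differentiable (by norm_num) x).hasDerivAt
  d₂ x := by
    have : ContDiff ℝ 1 (deriv f) := by
      have h := hf.1
      rw [show (2 : WithTop ℕ∞) = 1 + 1 by norm_num, contDiff_succ_iff_deriv] at h
      exact h.2.2
    rw [show iteratedDeriv 2 f = deriv (deriv f) by
      rw [iteratedDeriv_succ, iteratedDeriv_one]]
    exact (this.differentiable (by norm_num) x).hasDerivAt
  lip x y := by
    rcases eq_or_ne x y with rfl | hxy
    · simp
    · rw [← div_le_iff₀ (abs_pos.2 (sub_ne_zero.2 hxy))]
      exact le_csSup hf.2 ⟨x, y, hxy, rfl⟩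

variable {c : E} {f : ℝ → E}

theorem iteratedDeriv_two_cube (hf : ∀ x, f x = x ^ 3 • c) :
    iteratedDeriv 2 f = fun x => (6 * x) • c := by
  have h₁ : deriv f = fun x => (3 * x ^ 2) • c := by
    funext x
    rw [funext hf]
    exact (((hasDerivAt_pow 3 x).smul_const c).congr_deriv (by norm_num)).deriv
  rw [iteratedDeriv_succ, iteratedDeriv_one, h₁]
  funext x
  exact ((((hasDerivAt_pow 2 x).const_mul 3).smul_const c).congr_deriv
    (by congr 1; norm_num; ring)).deriv

theorem lipQuotients_cube (hf : ∀ x, f x = x ^ 3 • c) :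
    lipQuotients (iteratedDeriv 2 f) = {6 * ‖c‖} := by
  rw [iteratedDeriv_two_cube hf]
  have (x y : ℝ) (hxy : x ≠ y) : ‖(6 * x) • c - (6 * y) • c‖ / |x - y| = 6 * ‖c‖ := by
    have h := abs_pos.2 (sub_ne_zero.2 hxy)
    rw [← sub_smul, ← mul_sub, norm_smul, Real.norm_eq_abs, abs_mul, abs_of_pos (by norm_num)]
    field_simp
  ext r
  constructor
  · rintro ⟨x, y, hxy, rfl⟩
    exact this x y hxy
  · rintro rfl
    exact ⟨0, 1, zero_ne_one, (this 0 1 zero_ne_one).symm⟩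

theorem isC21_cube (hf : ∀ x, f x = x ^ 3 • c) : IsC21 f := by
  refine ⟨?_, ?_⟩
  · rw [funext hf]; fun_prop
  · rw [lipQuotients_cube hf]; exact bddAbove_singleton

theorem lipNorm_cube (hf : ∀ x, f x = x ^ 3 • c) : lipNorm (iteratedDeriv 2 f) = 6 * ‖c‖ := by
  rw [lipNorm, lipQuotients_cube hf, csSup_singleton]

end Smooth

/-! ### Assembly of the inequality, equality and binomial cases -/

section Main

variable {E : Type*} [NormedAddCommGroup E] [NormedSpace ℝ E] [CompleteSpace E] {n : ℕ}

theorem rademacher_inequality {P : Fin n → Measure ℝ} (hP : ∀ i, IsP3 (P i)) {f : ℝ → E}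
    (hf : IsC21 f) :
    Integrable f (standardize (convolution P)) ∧
      Integrable f (standardize (convolution fun i => symTwoPoint (sd (P i)))) ∧
      ‖∫ x, f x ∂(standardize (convolution P))
          - ∫ x, f x ∂(standardize (convolution fun i => symTwoPoint (sd (P i))))‖
        ≤ lipNorm (iteratedDeriv 2 f) / 6 *
            ∑ i, sd (P i) ^ 3 / √(∑ j, sd (P j) ^ 2) ^ 3 * B (rho (P i)) := by
  rw [IsP3.standardize_convolution hP, standardize_convolution_symTwoPoint]
  set σ := √(∑ j, sd (P j) ^ 2)
  have hσ : 0 ≤ σ := Real.sqrt_nonneg _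
  have hg := hf.lipSecond.comp_affine σ⁻¹ 0
  simp only [add_zero, abs_of_nonneg (inv_nonneg.2 hσ)] at hg
  have hC (i : Fin n) := (hP i).centred_centre
  have hS (i : Fin n) := centred_symTwoPoint (sd (P i))
  have (i : Fin n) := (hC i).isProb
  have (i : Fin n) := (hS i).isProb
  have := isProbabilityMeasure_convolution fun i => centre (P i)
  have := isProbabilityMeasure_convolution fun i => symTwoPoint (sd (P i))
  have hfc := hf.lipSecond.continuous
  refine ⟨?_, ?_, ?_⟩
  · rw [integrable_map_measure hfc.aestronglyMeasurable (by fun_prop)]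
    exact hg.integrable (integrable_abs_pow_three_convolution fun i => (hC i).moment)
  · rw [integrable_map_measure hfc.aestronglyMeasurable (by fun_prop)]
    exact hg.integrable (integrable_abs_pow_three_convolution fun i => (hS i).moment)
  · rw [integral_map (by fun_prop) hfc.aestronglyMeasurable,
      integral_map (by fun_prop) hfc.aestronglyMeasurable]
    refine (norm_integral_convolution_sub_le (fun i => (hC i).moment) (fun i => (hS i).moment)
      (fun i g g₁ g₂ h => (hP i).norm_integral_centre_sub_le h) hg).trans_eq ?_
    rw [Finset.mul_sum]
    refine Finset.sum_congr rfl fun i _ => ?_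
    ring

theorem rademacher_equality {P : Fin n → Measure ℝ} (hP : ∀ i, IsP3 (P i))
    (h2 : ∀ i, IsTwoPoint (P i))
    (hsign : (∀ i, 0 ≤ centredThird (P i)) ∨ (∀ i, centredThird (P i) ≤ 0)) {c : E} {f : ℝ → E}
    (hf : ∀ x, f x = x ^ 3 • c) :
    ‖∫ x, f x ∂(standardize (convolution P))
        - ∫ x, f x ∂(standardize (convolution fun i => symTwoPoint (sd (P i))))‖
      = lipNorm (iteratedDeriv 2 f) / 6 *
          ∑ i, sd (P i) ^ 3 / √(∑ j, sd (P j) ^ 2) ^ 3 * B (rho (P i)) := by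
  rw [IsP3.standardize_convolution hP, standardize_convolution_symTwoPoint, lipNorm_cube hf]
  set σ := √(∑ j, sd (P j) ^ 2)
  have hσ : 0 ≤ σ := Real.sqrt_nonneg _
  have hfc := (isC21_cube hf).lipSecond.continuous
  have cube (ν : Measure ℝ) :
      ∫ x, f x ∂(ν.map fun x => σ⁻¹ * x) = (σ⁻¹ ^ 3 * ∫ x, x ^ 3 ∂ν) • c := by
    rw [integral_map (by fun_prop) hfc.aestronglyMeasurable]
    simp_rw [hf, mul_pow]
    rw [integral_smul_const, integral_const_mul]
  obtain ⟨-, -, h₃⟩ := Centred.convolution fun i => (hP i).centred_centre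
  obtain ⟨-, -, k₃⟩ := Centred.convolution fun i => centred_symTwoPoint (sd (P i))
  have e₁ (i : Fin n) : ∫ x, x ^ 3 ∂(centre (P i)) = centredThird (P i) :=
    IsP3.integral_centre (by fun_prop)
  have e₂ (i : Fin n) : ∫ x, x ^ 3 ∂(symTwoPoint (sd (P i))) = 0 := by
    rw [integral_symTwoPoint]; simp; ring
  -- The only place where the common sign matters: the triangle inequality for the sum of third
  -- moments becomes an equality.
  have habs : |∑ i, centredThird (P i)| = ∑ i, sd (P i) ^ 3 * B (rho (P i)) := by
    simp_rw [fun i => (h2 i).sd_pow_mul_B]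
    rcases hsign with h | h
    · rw [abs_of_nonneg (Finset.sum_nonneg fun i _ => h i)]
      exact Finset.sum_congr rfl fun i _ => (abs_of_nonneg (h i)).symm
    · rw [abs_of_nonpos (Finset.sum_nonpos fun i _ => h i), ← Finset.sum_neg_distrib]
      exact Finset.sum_congr rfl fun i _ => (abs_of_nonpos (h i)).symm
  rw [cube, cube, h₃, k₃]
  simp_rw [e₁, e₂]
  rw [Finset.sum_const_zero, mul_zero, zero_smul, sub_zero, norm_smul, Real.norm_eq_abs, abs_mul,
    habs, abs_of_nonneg (by positivity), Finset.mul_sum, Finset.sum_mul, Finset.mul_sum]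
  refine Finset.sum_congr rfl fun i _ => ?_
  ring

theorem standardize_convolution_symTwoPoint_const (n : ℕ) {s : ℝ} (hs : 0 < s) :
    standardize (convolution fun _ : Fin n => symTwoPoint s) = standardize (symBinomial n) := by
  have := isProbabilityMeasure_half_diracs 0 1
  have hi : Integrable (fun x : ℝ => |x| ^ 3)
      ((2⁻¹ : ENNReal) • (Measure.dirac (0 : ℝ) + Measure.dirac 1)) := by
    rw [smul_add]
    exact integrable_two_diracs _ _ _ (by simp) (by simp)
  have := isProbabilityMeasure_convolution fun _ : Fin n =>
    (2⁻¹ : ENNReal) • (Measure.dirac (0 : ℝ) + Measure.dirac 1)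
  -- Each factor is an affine image of the law on `{0, 1}` with the same slope `2 * s > 0`, and
  -- standardization forgets such a map.
  simp_rw [symTwoPoint_eq_map s]
  rw [convolution_map_affine, standardize_map_affine _ (by positivity)]
  · rfl
  · simpa using integrable_pow (integrable_abs_pow_three_convolution fun _ : Fin n => hi)
      (k := 1) (by norm_num)

theorem sum_const_eq_div_sqrt (hn : 1 ≤ n) {s : ℝ} (hs : 0 < s) (b : ℝ) :
    ∑ _i : Fin n, s ^ 3 / √(∑ _j : Fin n, s ^ 2) ^ 3 * b = b / √n := by
  have hn0 : (0 : ℝ) < n := by exact_mod_cast hn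
  simp only [Finset.sum_const, Finset.card_univ, Fintype.card_fin, nsmul_eq_mul]
  rw [Real.sqrt_mul hn0.le, Real.sqrt_sq hs.le]
  have h : √(n : ℝ) ^ 2 = n := Real.sq_sqrt hn0.le
  have h0 : 0 < √(n : ℝ) := Real.sqrt_pos.2 hn0
  field_simp
  rw [h]

end Main

end RademacherApprox

open RademacherApprox in
theorem theorem1p2 {E : Type*} [NormedAddCommGroup E] [NormedSpace ℝ E] [CompleteSpace E]
    (n : ℕ) (hn : 1 ≤ n) :
    -- the inequality for general summands, including the existence of the integrals
    (∀ P : Fin n → Measure ℝ, (∀ i, IsP3 (P i)) → ∀ f : ℝ → E, IsC21 f →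
      Integrable f (standardize (convolution P)) ∧
      Integrable f (standardize (convolution fun i => symTwoPoint (sd (P i)))) ∧
      ‖∫ x, f x ∂(standardize (convolution P))
          - ∫ x, f x ∂(standardize (convolution fun i => symTwoPoint (sd (P i))))‖
        ≤ lipNorm (iteratedDeriv 2 f) / 6 *
            ∑ i, sd (P i) ^ 3 / √(∑ j, sd (P j) ^ 2) ^ 3 * B (rho (P i))) ∧
    -- the equality statement
    (∀ P : Fin n → Measure ℝ, (∀ i, IsP3 (P i)) → (∀ i, IsTwoPoint (P i)) →
      ((∀ i, 0 ≤ centredThird (P i)) ∨ (∀ i, centredThird (P i) ≤ 0)) →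
      ∀ (c : E) (f : ℝ → E), (∀ x, f x = x ^ 3 • c) →
        IsC21 f ∧
        ‖∫ x, f x ∂(standardize (convolution P))
            - ∫ x, f x ∂(standardize (convolution fun i => symTwoPoint (sd (P i))))‖
          = lipNorm (iteratedDeriv 2 f) / 6 *
              ∑ i, sd (P i) ^ 3 / √(∑ j, sd (P j) ^ 2) ^ 3 * B (rho (P i))) ∧
    -- in the homoscedastic case the comparison law is the standardized symmetric binomial law
    (∀ P : Fin n → Measure ℝ, (∀ i, IsP3 (P i)) → (∀ i j, sd (P i) = sd (P j)) →
      standardize (convolution fun i => symTwoPoint (sd (P i))) = standardize (symBinomial n)) ∧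
    -- the i.i.d. case
    (∀ P : Measure ℝ, IsP3 P →
      (∑ _i : Fin n, sd P ^ 3 / √(∑ _j : Fin n, sd P ^ 2) ^ 3 * B (rho P) = B (rho P) / √n) ∧
      (∀ f : ℝ → E, IsC21 f →
        Integrable f (standardize (convPow P n)) ∧
        Integrable f (standardize (symBinomial n)) ∧
        ‖∫ x, f x ∂(standardize (convPow P n)) - ∫ x, f x ∂(standardize (symBinomial n))‖
          ≤ B (rho P) / (6 * √n) * lipNorm (iteratedDeriv 2 f)) ∧
      (IsTwoPoint P → ∀ (c : E) (f : ℝ → E), (∀ x, f x = x ^ 3 • c) →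
        ‖∫ x, f x ∂(standardize (convPow P n)) - ∫ x, f x ∂(standardize (symBinomial n))‖
          = B (rho P) / (6 * √n) * lipNorm (iteratedDeriv 2 f))) := by
  refine ⟨fun P hP f hf => rademacher_inequality hP hf, fun P hP h2 hsign c f hf =>
    ⟨isC21_cube hf, rademacher_equality hP h2 hsign hf⟩, fun P hP hsd => ?_, fun P hP => ?_⟩
  · have h0 : 0 < n := hn
    have e (i : Fin n) : sd (P i) = sd (P ⟨0, h0⟩) := hsd _ _
    simp_rw [e]
    exact standardize_convolution_symTwoPoint_const n (hP _).sd_pos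
  · have hsum := sum_const_eq_div_sqrt hn hP.sd_pos (B (rho P))
    have hbin := standardize_convolution_symTwoPoint_const n hP.sd_pos
    have hr (K : ℝ) : K / 6 * (B (rho P) / √n) = B (rho P) / (6 * √n) * K := by
      rw [div_mul_div_comm, mul_comm K, mul_div_right_comm]
    refine ⟨hsum, fun f hf => ?_, fun h2 c f hf => ?_⟩
    · have := rademacher_inequality (fun _ : Fin n => hP) hf
      rw [hsum, hbin, hr] at this
      exact this
    · have := rademacher_equality (fun _ : Fin n => hP) (fun _ => h2)
        ((le_total 0 (centredThird P)).imp (fun h _ => h) (fun h _ => h)) hf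
      rw [hsum, hbin, hr] at this
      exact this
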